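/- Let $0\le m_0<n_0$ be integers, $\alpha=m_0/n_0$, and let $\lambda,\eta,\beta>0$. Let $A=\{i\ge 1:\ (i \bmod n_0)\in\{1,\dots,m_0\}\}$ (labels of the thermostated particles) and $B=\mathbb{N}_{\ge 1}\setminus A$. Let $g_\beta(x)=\sqrt{\beta/(2\pi)}\,e^{-\beta x^2/2}$. On $L^1(\mathbb{R}^n)$ let $$Q_{ij}f(v)=\frac1{2\pi}\int_0^{2\pi} f(v_1,\dots,v_i\cos\theta-v_j\sin\theta,\dots,v_i\sin\theta+v_j\cos\theta,\dots,v_n)\,d\theta\qquad(i<j),$$ $$Q=\binom n2^{-1}\sum_{i<j}Q_{ij},\qquad P_if(v)=g_\beta(v_i)\int_{\mathbb{R}}f(v_1,\dots,v_{i-1},w,v_{i+1},\dots,v_n)\,dw,$$ and, for $n=kn_0$ (so that $km_0$ of the particles are thermostated), let the generator of the partially thermostated Kac model be the bounded operator $$-L_{km_0,kn_0}=n\lambda(Q-I)+\eta\sum_{i\in A,\ i\le n}(P_i-I).$$ Call a sequence $F_k\in L^1(\mathbb{R}^{kn_0})$, $k\ge1$, chaotic with marginals $(a,b)$, where $a,b$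 are probability densities on $\mathbb{R}$, if for every $l$ and every $\varphi\in L^\infty(\mathbb{R}^l)$ $$\lim_{k\to\infty}\int_{\mathbb{R}^{kn_0}}F_k(v)\,\varphi(v_1,\dots,v_l)\,dv=\int_{\mathbb{R}^l}\prod_{i\in A,\,i\le l}a(v_i)\prod_{j\in B,\,j\le l}b(v_j)\ \varphi(v_1,\dots,v_l)\,dv .$$ Theorem (propagation of chaos). Let $f_k\in L^1(\mathbb{R}^{kn_0})$, $k\ge1$, be probability densities that are symmetric under the exchange of particles with labels in $A$ and under the exchange of particles with labels in $B$, and suppose that $(f_k)$ is chaotic with marginals $(\bar f_0,\bar{\bar f}_0)$. Then the coupled Boltzmann–Kac system $$\frac{\partial \bar f}{\partial t}(t,v)=2\lambda\Big[\int_{\mathbb{R}}\frac1{2\pi}\int_0^{2\pi}\bar f(t,v^*)\big(\alpha\bar f(t,w^*)+(1-\alpha)\bar{\bar f}(t,w^*)\big)\,d\theta\,dw-\bar f(t,v)\Big]+\eta\Big(g_\beta(v)\int_{\mathbb{R}}\bar f(t,w)\,dw-\bar f(t,v)\Big),$$ $$\frac{\partial \bar{\bar f}}{\partial t}(t,v)=2\lambda\Big[\int_{\mathbb{R}}\frac1{2\pi}\int_0^{2\pi}\bar{\bar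 f}(t,v^*)\big(\alpha\bar f(t,w^*)+(1-\alpha)\bar{\bar f}(t,w^*)\big)\,d\theta\,dw-\bar{\bar f}(t,v)\Big],$$ with $v^*=v\cos\theta-w\sin\theta$, $w^*=v\sin\theta+w\cos\theta$ and initial condition $(\bar f,\bar{\bar f})(0)=(\bar f_0,\bar{\bar f}_0)$, has a solution $(\bar f,\bar{\bar f}):[0,\infty)\to L^1(\mathbb{R})\times L^1(\mathbb{R})$ that is differentiable in the $L^1$ norm (one-sidedly at $t=0$), and for every such solution and every $t\ge0$ the sequence $\big(e^{-tL_{km_0,kn_0}}f_k\big)_k$ is chaotic with marginals $(\bar f(t),\bar{\bar f}(t))$. -/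

import Mathlib

open MeasureTheory Filter Topology Set

noncomputable section

namespace PartialKac

/-! ### Averaging operators on `L¹` -/

section Averaging

variable {T X : Type*} [MeasurableSpace T] [MeasurableSpace X]

/-- `f ↦ k · (f ∘ Φ)` is bounded from `L¹(μ)` to `L¹(τ × μ)`, with norm at most `C`. -/
structure IsAveraging (τ : Measure T) (μ : Measure X) (k : T × X → ℝ) (Φ : T × X → X) (C : ℝ) :
    Prop where
  integrable : ∀ f : X → ℝ, Integrable f μ → Integrable (fun p => k p * f (Φ p)) (τ.prod μ)
  bound : ∀ f : X → ℝ, Integrable f μ →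
    ∫ p, ‖k p * f (Φ p)‖ ∂(τ.prod μ) ≤ C * ∫ x, ‖f x‖ ∂μ

/-- The averaged function `x ↦ ∫ k(s, x) f(Φ(s, x)) τ(ds)`. -/
def avg (τ : Measure T) (k : T × X → ℝ) (Φ : T × X → X) (f : X → ℝ) (x : X) : ℝ :=
  ∫ s, k (s, x) * f (Φ (s, x)) ∂τ

variable {τ : Measure T} {μ : Measure X} [SFinite τ] [SFinite μ] {k : T × X → ℝ}
  {Φ : T × X → X} {C : ℝ}

theorem IsAveraging.integrable_avg (h : IsAveraging τ μ k Φ C) {f : X → ℝ}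
    (hf : Integrable f μ) : Integrable (avg τ k Φ f) μ :=
  (h.integrable f hf).integral_prod_right

theorem IsAveraging.norm_avg (h : IsAveraging τ μ k Φ C) {f : X → ℝ}
    (hf : Integrable f μ) : ∫ x, ‖avg τ k Φ f x‖ ∂μ ≤ C * ∫ x, ‖f x‖ ∂μ := by
  refine le_trans ?_ (h.bound f hf)
  rw [integral_prod_symm _ (h.integrable f hf).norm]
  refine integral_mono (h.integrable_avg hf).norm
    (h.integrable f hf).norm.integral_prod_right fun x => ?_
  exact norm_integral_le_integral_norm _

theorem IsAveraging.avg_add (h : IsAveraging τ μ k Φ C) {f g : X → ℝ}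
    (hf : Integrable f μ) (hg : Integrable g μ) :
    avg τ k Φ (f + g) =ᵐ[μ] avg τ k Φ f + avg τ k Φ g := by
  filter_upwards [(h.integrable f hf).prod_left_ae, (h.integrable g hg).prod_left_ae]
    with x h1 h2
  simp only [avg, Pi.add_apply, mul_add]
  exact integral_add h1 h2

theorem avg_smul (c : ℝ) (f : X → ℝ) : avg τ k Φ (c • f) = c • avg τ k Φ f := by
  funext x
  simp only [avg, Pi.smul_apply, smul_eq_mul, mul_left_comm _ c]
  exact integral_const_mul _ _

theorem IsAveraging.avg_congr (h : IsAveraging τ μ k Φ C) {f g : X → ℝ}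
    (hf : Integrable f μ) (hg : Integrable g μ) (hfg : f =ᵐ[μ] g) :
    avg τ k Φ f =ᵐ[μ] avg τ k Φ g := by
  have hd : Integrable (f - g) μ := hf.sub hg
  have h0 : ∫ x, ‖(f - g) x‖ ∂μ = 0 := by
    rw [integral_eq_zero_iff_of_nonneg (fun x => norm_nonneg _) hd.norm]
    filter_upwards [hfg] with x hx
    simp [hx]
  have h1 := h.norm_avg hd
  rw [h0, mul_zero] at h1
  have h2 := le_antisymm h1 (integral_nonneg fun x => norm_nonneg _)
  rw [integral_eq_zero_iff_of_nonneg (fun x => norm_nonneg _) (h.integrable_avg hd).norm] at h2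
  have h3 := h.avg_add hd hg
  rw [sub_add_cancel] at h3
  filter_upwards [h2, h3] with x hx1 hx2
  rw [hx2, Pi.add_apply, norm_eq_zero.mp hx1, zero_add]

/-- The bounded operator on `L¹(μ)` that sends (the class of) `f` to (the class of) the function
`x ↦ ∫ k(s, x) f(Φ(s, x)) τ(ds)`. -/
def avgOp (h : IsAveraging τ μ k Φ C) : Lp ℝ 1 μ →L[ℝ] Lp ℝ 1 μ :=
  LinearMap.mkContinuous
    { toFun := fun f => (h.integrable_avg (L1.integrable_coeFn f)).toL1 (avg τ k Φ f)
      map_add' := fun f g => by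
        rw [← Integrable.toL1_add, Integrable.toL1_eq_toL1_iff]
        exact (h.avg_congr (L1.integrable_coeFn _)
          ((L1.integrable_coeFn f).add (L1.integrable_coeFn g)) (Lp.coeFn_add f g)).trans
          (h.avg_add (L1.integrable_coeFn f) (L1.integrable_coeFn g))
      map_smul' := fun c f => by
        rw [RingHom.id_apply, ← Integrable.toL1_smul, Integrable.toL1_eq_toL1_iff]
        refine (h.avg_congr (L1.integrable_coeFn _)
          ((L1.integrable_coeFn f).smul c) (Lp.coeFn_smul c f)).trans ?_
        exact Filter.EventuallyEq.of_eq (avg_smul c f) }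
    C
    (fun f => by
      rw [L1.norm_eq_integral_norm, L1.norm_eq_integral_norm]
      refine le_trans (le_of_eq (integral_congr_ae ?_)) (h.norm_avg (L1.integrable_coeFn f))
      filter_upwards [Integrable.coeFn_toL1 (h.integrable_avg (L1.integrable_coeFn f))] with x hx
      exact congrArg norm hx)

end Averaging

/-! ### Collisions and thermostats for `n` particles -/

/-- `L¹(ℝⁿ)`. -/
abbrev L1 (n : ℕ) : Type := Lp ℝ 1 (volume : Measure (Fin n → ℝ))

/-- `L¹(ℝ)`. -/
abbrev L1R : Type := Lp ℝ 1 (volume : Measure ℝ)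

/-- The velocities `(v₁, …, vᵢ*(θ), …, vⱼ*(θ), …, vₙ)` after the collision of particles `i ≠ j`
with angle `θ`. -/
def rotate {n : ℕ} (i j : Fin n) (θ : ℝ) (v : Fin n → ℝ) : Fin n → ℝ :=
  Function.update
    (Function.update v i (v i * Real.cos θ - v j * Real.sin θ))
    j (v i * Real.sin θ + v j * Real.cos θ)

/-- The uniform probability measure on the interval `(0, 2π]` of collision angles. -/
def angle : Measure ℝ :=
  ENNReal.ofReal (2 * Real.pi)⁻¹ • (volume : Measure ℝ).restrict (Ioc 0 (2 * Real.pi))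

instance : IsProbabilityMeasure angle := ⟨by
  have : (0 : ℝ) < 2 * Real.pi := by positivity
  rw [angle, Measure.smul_apply, Measure.restrict_apply_univ, Real.volume_Ioc, sub_zero,
    smul_eq_mul, ← ENNReal.ofReal_mul (by positivity), inv_mul_cancel₀ this.ne',
    ENNReal.ofReal_one]⟩

theorem rotate_apply {n : ℕ} {i j : Fin n} (hij : i ≠ j) (θ : ℝ) (v : Fin n → ℝ) (l : Fin n) :
    rotate i j θ v l = if l = i then v i * Real.cos θ - v j * Real.sin θ
      else if l = j then v i * Real.sin θ + v j * Real.cos θ else v l := by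
  by_cases h1 : l = i
  · subst h1; simp [rotate, hij]
  · by_cases h2 : l = j
    · subst h2; simp [rotate, h1]
    · simp [rotate, h1, h2]

/-- `rotate` as a linear map. -/
def rotateLin {n : ℕ} {i j : Fin n} (hij : i ≠ j) (θ : ℝ) : (Fin n → ℝ) →ₗ[ℝ] (Fin n → ℝ) where
  toFun := rotate i j θ
  map_add' v w := by
    funext l
    simp only [rotate_apply hij, Pi.add_apply]
    split_ifs <;> ring
  map_smul' c v := by
    funext l
    simp only [rotate_apply hij, Pi.smul_apply, smul_eq_mul, RingHom.id_apply]
    split_ifs <;> ring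

theorem measurePreserving_rotate {n : ℕ} {i j : Fin n} (hij : i ≠ j) (θ : ℝ) :
    MeasurePreserving (rotate i j θ) volume volume := by
  have hinv : rotateLin hij θ ∘ₗ rotateLin hij (-θ) = LinearMap.id := by
    ext1 l
    ext1
    funext m
    simp only [rotateLin, LinearMap.coe_comp, LinearMap.coe_mk, AddHom.coe_mk, Function.comp_apply,
      rotate_apply hij, Real.cos_neg, Real.sin_neg, LinearMap.id_coe, id_eq, if_true, hij.symm,
      if_false]
    have := Real.sin_sq_add_cos_sq θ
    split_ifs with h1 h2
    · subst h1; linear_combination (LinearMap.single ℝ (fun _ => ℝ) l 1 m) * this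
    · subst h2; linear_combination (LinearMap.single ℝ (fun _ => ℝ) l 1 m) * this
    · rfl
  have hconj : rotateLin hij (-θ) =
      ((LinearEquiv.funCongrLeft ℝ ℝ (Equiv.swap i j) : (Fin n → ℝ) →ₗ[ℝ] (Fin n → ℝ)) ∘ₗ
        rotateLin hij θ ∘ₗ
        ((LinearEquiv.funCongrLeft ℝ ℝ (Equiv.swap i j)).symm :
          (Fin n → ℝ) →ₗ[ℝ] (Fin n → ℝ))) := by
    refine LinearMap.ext fun v => funext fun m => ?_
    simp only [rotateLin, LinearMap.coe_comp, LinearMap.coe_mk, AddHom.coe_mk, Function.comp_apply,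
      LinearEquiv.coe_coe, LinearEquiv.funCongrLeft_apply, LinearEquiv.funCongrLeft_symm,
      LinearMap.funLeft_apply, Equiv.symm_swap, rotate_apply hij, Real.cos_neg, Real.sin_neg]
    by_cases h1 : m = i
    · subst h1; simp [hij.symm]; ring
    · by_cases h2 : m = j
      · subst h2; simp [h1]; ring
      · simp [h1, h2, Equiv.swap_apply_of_ne_of_ne]
  have hdet : LinearMap.det (rotateLin hij θ) * LinearMap.det (rotateLin hij θ) = 1 := by
    have h1 := congrArg LinearMap.det hinv
    rw [LinearMap.det_comp, LinearMap.det_id, hconj, LinearMap.det_conj] at h1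
    exact h1
  have hne : LinearMap.det (rotateLin hij θ) ≠ 0 := left_ne_zero_of_mul_eq_one hdet
  have habs : |(LinearMap.det (rotateLin hij θ))⁻¹| = 1 := by
    rcases mul_self_eq_one_iff.mp hdet with h | h <;> simp [h]
  refine ⟨(rotateLin hij θ).continuous_of_finiteDimensional.measurable, ?_⟩
  have := Measure.map_linearMap_addHaar_eq_smul_addHaar
    (volume : Measure (Fin n → ℝ)) hne
  rw [habs, ENNReal.ofReal_one, one_smul] at this
  exact this

theorem isAveraging_rotate {n : ℕ} {i j : Fin n} (hij : i ≠ j) :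
    IsAveraging angle (volume : Measure (Fin n → ℝ)) (fun _ => 1)
      (fun p => rotate i j p.1 p.2) 1 := by
  have hm : Measurable fun p : ℝ × (Fin n → ℝ) => rotate i j p.1 p.2 := by
    refine measurable_pi_lambda _ fun l => ?_
    simp only [rotate_apply hij]
    split_ifs <;> fun_prop
  have hmp : MeasurePreserving (fun p : ℝ × (Fin n → ℝ) => rotate i j p.1 p.2)
      (angle.prod volume) volume :=
    measurePreserving_snd.comp
      ((MeasurePreserving.id angle).skew_product (g := fun θ v => rotate i j θ v) hm
        (Eventually.of_forall fun θ => (measurePreserving_rotate hij θ).map_eq))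
  constructor
  · intro f hf
    simp only [one_mul]
    exact hmp.integrable_comp_of_integrable hf
  · intro f hf
    simp only [one_mul]
    have hf' : AEStronglyMeasurable (fun x => ‖f x‖)
        ((angle.prod volume).map fun p : ℝ × (Fin n → ℝ) => rotate i j p.1 p.2) := by
      rw [hmp.map_eq]; exact hf.norm.aestronglyMeasurable
    have := integral_map hmp.aemeasurable hf'
    rw [hmp.map_eq] at this
    exact this.symm.le

/-- The collision operator of particles `i ≠ j` on `L¹(ℝⁿ)`:
`Q_{ij} f(v) = (2π)⁻¹ ∫₀^{2π} f(v₁, …, vᵢ*(θ), …, vⱼ*(θ), …, vₙ) dθ`. -/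
def collisionOp {n : ℕ} (i j : Fin n) (hij : i ≠ j) : L1 n →L[ℝ] L1 n :=
  avgOp (isAveraging_rotate hij)

/-- The Gaussian `g_β(x) = √(β / 2π) exp(-β x² / 2)`. -/
def gauss (β x : ℝ) : ℝ := ProbabilityTheory.gaussianPDFReal 0 (Real.toNNReal β⁻¹) x

theorem gauss_eq {β : ℝ} (hβ : 0 < β) (x : ℝ) :
    gauss β x = Real.sqrt (β / (2 * Real.pi)) * Real.exp (-(β / 2) * x ^ 2) := by
  have h : (0 : ℝ) < β⁻¹ := inv_pos.mpr hβ
  rw [gauss, ProbabilityTheory.gaussianPDFReal, Real.coe_toNNReal _ h.le, ← Real.sqrt_inv]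
  congr 2
  · field_simp
  · field_simp
    ring

/-- The exchange of `w` and `vᵢ`. -/
def exchange {n : ℕ} (i : Fin n) : (ℝ × (Fin n → ℝ)) →ₗ[ℝ] (ℝ × (Fin n → ℝ)) where
  toFun p := (p.2 i, Function.update p.2 i p.1)
  map_add' p q := by
    refine Prod.ext rfl (funext fun l => ?_)
    by_cases h : l = i
    · subst h; simp
    · simp [h]
  map_smul' c p := by
    refine Prod.ext rfl (funext fun l => ?_)
    by_cases h : l = i
    · subst h; simp
    · simp [h]

theorem measurePreserving_exchange {n : ℕ} (i : Fin n) :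
    MeasurePreserving (fun p : ℝ × (Fin n → ℝ) => (p.2 i, Function.update p.2 i p.1))
      (volume.prod volume) (volume.prod volume) := by
  have hinv : exchange i ∘ₗ exchange i = LinearMap.id := by
    refine LinearMap.ext fun p => ?_
    simp [exchange]
  have hdet : LinearMap.det (exchange i) * LinearMap.det (exchange i) = 1 := by
    rw [← LinearMap.det_comp, hinv, LinearMap.det_id]
  have hne : LinearMap.det (exchange i) ≠ 0 := left_ne_zero_of_mul_eq_one hdet
  have habs : |(LinearMap.det (exchange i))⁻¹| = 1 := by
    rcases mul_self_eq_one_iff.mp hdet with h | h <;> simp [h]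
  refine ⟨(exchange i).continuous_of_finiteDimensional.measurable, ?_⟩
  have := Measure.map_linearMap_addHaar_eq_smul_addHaar
    ((volume : Measure ℝ).prod (volume : Measure (Fin n → ℝ))) hne
  rw [habs, ENNReal.ofReal_one, one_smul] at this
  exact this

theorem isAveraging_thermostat {n : ℕ} (β : ℝ) (i : Fin n) :
    IsAveraging (volume : Measure ℝ) (volume : Measure (Fin n → ℝ)) (fun p => gauss β (p.2 i))
      (fun p => Function.update p.2 i p.1) (∫ x, ‖gauss β x‖) := by
  have hg : Integrable (gauss β) := ProbabilityTheory.integrable_gaussianPDFReal _ _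
  have hmp := measurePreserving_exchange i
  have hint : ∀ f : (Fin n → ℝ) → ℝ, Integrable f →
      Integrable (fun q : ℝ × (Fin n → ℝ) => gauss β q.1 * f q.2) (volume.prod volume) :=
    fun f hf => hg.mul_prod hf
  constructor
  · intro f hf
    exact hmp.integrable_comp_of_integrable (hint f hf)
  · intro f hf
    have hf' : AEStronglyMeasurable (fun q : ℝ × (Fin n → ℝ) => ‖gauss β q.1 * f q.2‖)
        ((volume.prod volume).map
          fun p : ℝ × (Fin n → ℝ) => (p.2 i, Function.update p.2 i p.1)) := by
      rw [hmp.map_eq]; exact (hint f hf).norm.aestronglyMeasurable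
    have := integral_map hmp.aemeasurable hf'
    rw [hmp.map_eq] at this
    rw [← this]
    simp only [norm_mul]
    exact (integral_prod_mul (fun x => ‖gauss β x‖) fun x => ‖f x‖).le

/-- The strong thermostat on particle `i`:
`P_i f(v) = g_β(vᵢ) ∫ f(v₁, …, vᵢ₋₁, w, vᵢ₊₁, …, vₙ) dw`. -/
def thermostatOp {n : ℕ} (β : ℝ) (i : Fin n) : L1 n →L[ℝ] L1 n :=
  avgOp (isAveraging_thermostat β i)

/-! ### The partially thermostated Kac model -/

/-- The set of (zero-based) positions of the thermostated particles: the particle with position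
`i`, that is, with label `i + 1 ∈ {1, 2, …}`, is thermostated if its label is congruent to one of
`1, …, m₀` modulo `n₀`. -/
def thermostated (m₀ n₀ : ℕ) : Set ℕ := {i | (i + 1) % n₀ ∈ Finset.Icc 1 m₀}

instance (m₀ n₀ : ℕ) : DecidablePred (· ∈ thermostated m₀ n₀) := fun i =>
  inferInstanceAs (Decidable ((i + 1) % n₀ ∈ Finset.Icc 1 m₀))

/-- The average `Q = (n choose 2)⁻¹ ∑_{i < j} Q_{ij}` of the collision operators. -/
def meanCollisionOp (n : ℕ) : L1 n →L[ℝ] L1 n :=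
  (n.choose 2 : ℝ)⁻¹ •
    ∑ p : {p : Fin n × Fin n // p.1 < p.2}, collisionOp p.1.1 p.1.2 p.2.ne

/-- The generator `-L = n lam (Q - I) + η ∑_{i thermostated} (P_i - I)` for `n` particles. -/
def generator (m₀ n₀ n : ℕ) (lam η β : ℝ) : L1 n →L[ℝ] L1 n :=
  (n * lam) • (meanCollisionOp n - ContinuousLinearMap.id ℝ (L1 n)) +
    η • ∑ i : Fin n with i.val ∈ thermostated m₀ n₀,
      (thermostatOp β i - ContinuousLinearMap.id ℝ (L1 n))

/-- The evolution operator `e^{-tL}` on `L¹(ℝⁿ)`. -/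
def evolution (m₀ n₀ n : ℕ) (lam η β t : ℝ) : L1 n →L[ℝ] L1 n :=
  NormedSpace.exp (t • generator m₀ n₀ n lam η β)

/-- `f` is a probability density. -/
def IsProbDensity {X : Type*} [MeasureSpace X] (f : Lp ℝ 1 (volume : Measure X)) : Prop :=
  (∀ᵐ x, 0 ≤ f x) ∧ ∫ x, f x = 1

/-- `f` is invariant under the exchange of two thermostated particles and under the exchange of
two particles that are not thermostated. -/
def IsPartiallySymmetric (m₀ n₀ : ℕ) {n : ℕ} (f : L1 n) : Prop :=
  ∀ i j : Fin n, (i.val ∈ thermostated m₀ n₀ ↔ j.val ∈ thermostated m₀ n₀) →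
    (fun v : Fin n → ℝ => f (v ∘ Equiv.swap i j)) =ᵐ[volume] f

/-- `(v₁, …, v_l)`, for `v ∈ ℝⁿ`. It is filled up with zeros if `n < l`, which does not matter in
the limit of large `n`. -/
def firstCoords {n : ℕ} (l : ℕ) (v : Fin n → ℝ) : Fin l → ℝ :=
  fun i => if h : i.val < n then v ⟨i.val, h⟩ else 0

/-- The sequence `f k ∈ L¹(ℝ^{k n₀})` is chaotic with the marginal probability densities `a` for
the thermostated and `b` for the other particles: for all `l` and all `φ ∈ L^∞(ℝ^l)`, the integral
of `f k (v) φ(v₁, …, v_l)` tends to the integral of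
`∏_{i ≤ l thermostated} a(vᵢ) ∏_{j ≤ l not thermostated} b(vⱼ) φ(v₁, …, v_l)`. -/
def IsChaotic (m₀ n₀ : ℕ) (f : (k : ℕ) → L1 (k * n₀)) (a b : L1R) : Prop :=
  IsProbDensity a ∧ IsProbDensity b ∧
  ∀ (l : ℕ) (φ : (Fin l → ℝ) → ℝ), MemLp φ ⊤ volume →
    Tendsto (fun k => ∫ v : Fin (k * n₀) → ℝ, f k v * φ (firstCoords l v)) atTop
      (𝓝 (∫ v : Fin l → ℝ,
        (∏ i : Fin l, if i.val ∈ thermostated m₀ n₀ then a (v i) else b (v i)) * φ v))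

/-! ### The Boltzmann–Kac system -/

/-- The gain term `∫ (2π)⁻¹ ∫₀^{2π} f(v*(θ)) h(w*(θ)) dθ dw`. -/
def gain (f h : ℝ → ℝ) (v : ℝ) : ℝ :=
  ∫ w : ℝ, (2 * Real.pi)⁻¹ * ∫ θ in (0 : ℝ)..(2 * Real.pi),
    f (v * Real.cos θ - w * Real.sin θ) * h (v * Real.sin θ + w * Real.cos θ)

/-- `(a, b) : [0, ∞) → L¹(ℝ) × L¹(ℝ)` is differentiable (one-sidedly at `0`) for the `L¹` norm,
starts at `(a₀, b₀)` and solves the coupled Boltzmann–Kac system. -/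
structure IsBoltzmannKacSolution (α lam η β : ℝ) (a₀ b₀ : L1R) (a b : ℝ → L1R) : Prop where
  init_a : a 0 = a₀
  init_b : b 0 = b₀
  deriv_a : ∀ t, 0 ≤ t → ∃ a' : L1R, HasDerivWithinAt a a' (Ici 0) t ∧
    a' =ᵐ[volume] fun v =>
      2 * lam * (gain (a t) (fun w => α * a t w + (1 - α) * b t w) v - a t v)
        + η * (gauss β v * (∫ w, a t w) - a t v)
  deriv_b : ∀ t, 0 ≤ t → ∃ b' : L1R, HasDerivWithinAt b b' (Ici 0) t ∧
    b' =ᵐ[volume] fun v =>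
      2 * lam * (gain (b t) (fun w => α * a t w + (1 - α) * b t w) v - b t v)

end PartialKac

end

noncomputable section

namespace PartialKac

/-! ### Ordinary differential equations that leave a closed convex set invariant -/

section Invariance

open Metric
open scoped NNReal

variable {E : Type*} [NormedAddCommGroup E] [NormedSpace ℝ E]

/-! The evolved density is tested against a bounded function `φ` of `l` chosen particles, and the
generator is moved to `φ` by duality. Collisions between two particles that `φ` does not see
contribute nothing. A collision of an observed particle with an unobserved one gives an observable
of `l + 1` particles. The collisions among the `l` observed particles have total weight of order `1
/ n` and disappear in the limit (`abs_obs_generator_sub_le`). Since every block of `n₀` labels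
contains exactly `m₀` thermostated ones, the collision partner is thermostated with frequency `α =
m₀ / n₀`, up to `O(1 / n)`. The products of the densities solving the Boltzmann–Kac system satisfy
the resulting limiting hierarchy exactly, by the product rule and the identities `tens_collideNew`
and `tens_thermostatDual`.

The difference of the two hierarchies is estimated by iterating Duhamel's formula
(`eventually_abs_sub_meanField_le`). The adjoint operators do not increase the sup bound `K`, so `m`
iterations leave a remainder `2 K (C (s - t₀))^m l (l + 1) ⋯ (l + m - 1) / m!` with `C = 8 lam + 2
η`, which is at most `2 K 2^l (2 C (s - t₀))^m`. This tends to zero on time steps of length at most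
`1 / (4 C)`, a length independent of `l`, `φ` and `t₀`, so finitely many restarts reach any time.

Because the hierarchy sums over all collision partners, the property that is propagated is
convergence uniform in the choice of distinct particles of given species (`IsUniformlyChaotic`).
Partial symmetry of the initial data turns chaos into this uniform form
(`IsChaotic.isUniformlyChaotic`); symmetry at later times is not needed.

The a priori bounds are that the evolution contracts the `L¹` norm and that solutions of the system
remain pairs of probability densities. Both follow from one invariance principle,
`mem_of_hasDerivWithinAt`: an Euler step of length `1 / c` maps a closed convex set into itself,
hence so does the flow. Applied to a truncated vector field, the same principle yields global
existence. -/

theorem infDist_add_smul_le {v : E → E} {L : ℝ≥0} (hv : LipschitzWith L v) {K : Set E}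
    (hK : Convex ℝ K) (hne : K.Nonempty) {c : ℝ} (hc : 0 < c)
    (hvK : ∀ x ∈ K, x + c⁻¹ • v x ∈ K) (z : E) {h : ℝ} (h0 : 0 ≤ h) (hh : c * h ≤ 1) :
    infDist (z + h • v z) K ≤ (1 + h * L) * infDist z K := by
  have hpos : 0 < 1 + h * L := by positivity
  rw [← div_le_iff₀' hpos]
  refine (le_infDist hne).mpr fun y hy => ?_
  rw [div_le_iff₀' hpos]
  -- This is the convex combination of `y` and `y + c⁻¹ • v y` with weights `1 - c * h` and `c * h`.
  -- Since the Euler map is `(1 + h * L)`-Lipschitz, `z` can be compared with any `y` in `K`.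
  have hp : y + h • v y ∈ K := by
    have := hK hy (hvK y hy) (sub_nonneg.mpr hh) (mul_nonneg hc.le h0) (by ring)
    convert this using 1
    rw [smul_add, ← add_assoc, ← add_smul, smul_smul, sub_add_cancel, one_smul]
    congr 2
    field_simp
  refine (infDist_le_dist_of_mem hp).trans ?_
  have hvz := hv.dist_le_mul z y
  calc dist (z + h • v z) (y + h • v y) ≤ dist z y + dist (h • v z) (h • v y) :=
        dist_add_add_le _ _ _ _
    _ = dist z y + h * dist (v z) (v y) := by
        rw [dist_smul₀, Real.norm_of_nonneg h0]
    _ ≤ dist z y + h * (L * dist z y) := by gcongr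
    _ = _ := by ring

/-- A closed convex set `K` with `x + v(x) / c ∈ K` for `x ∈ K` is positively invariant under the
flow of the Lipschitz vector field `v`. -/
theorem mem_of_hasDerivWithinAt {v : E → E} {L : ℝ≥0} (hv : LipschitzWith L v) {K : Set E}
    (hK : Convex ℝ K) (hKc : IsClosed K) {c : ℝ} (hc : 0 < c)
    (hvK : ∀ x ∈ K, x + c⁻¹ • v x ∈ K) {x : ℝ → E} {T : ℝ}
    (hcont : ContinuousOn x (Icc 0 T))
    (hx : ∀ t ∈ Ico 0 T, HasDerivWithinAt x (v (x t)) (Ici t) t) (h0 : x 0 ∈ K) :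
    ∀ t ∈ Icc 0 T, x t ∈ K := by
  have hne : K.Nonempty := ⟨_, h0⟩
  -- Gronwall for the distance to `K`: it starts at zero, and its lower right derivative is at most
  -- `L` times the distance itself.
  have key := le_gronwallBound_of_liminf_deriv_right_le (f := fun t => infDist (x t) K)
    (f' := fun t => L * infDist (x t) K) (δ := 0) (K := L) (ε := 0) (a := 0) (b := T)
    ((continuous_infDist_pt K).comp_continuousOn hcont) ?_ (infDist_zero_of_mem h0).le
    (fun t _ => by simp)
  · intro t ht
    have h1 := key t ht
    rw [gronwallBound_ε0_δ0] at h1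
    exact (hKc.mem_iff_infDist_zero hne).mpr (le_antisymm h1 infDist_nonneg)
  · intro t ht r hr
    refine Eventually.frequently ?_
    -- Half of the gap absorbs the remainder of the first-order expansion of `x` at `t`; the other
    -- half keeps the inequality strict.
    set δ := (r - L * infDist (x t) K) / 2 with hδ
    have hδ0 : 0 < δ := by
      have : (L : ℝ) * infDist (x t) K < r := hr
      rw [hδ]; linarith
    have h1 := (hasDerivWithinAt_iff_isLittleO.mp (hx t ht)).def hδ0
    have h2 := h1.filter_mono (nhdsWithin_mono t Ioi_subset_Ici_self)
    have h3 : ∀ᶠ z in 𝓝[>] t, c * (z - t) < 1 := by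
      refine nhdsWithin_le_nhds (ContinuousAt.eventually_lt (f := fun z => c * (z - t))
        (g := fun _ => (1 : ℝ)) (by fun_prop) (by fun_prop) (by simp))
    filter_upwards [h2, h3, self_mem_nhdsWithin] with z hz1 hz2 hz3
    have hzt : 0 < z - t := sub_pos.mpr hz3
    have h4 := infDist_add_smul_le hv hK hne hc hvK (x t) hzt.le hz2.le
    have h5 : infDist (x z) K ≤ infDist (x t + (z - t) • v (x t)) K
        + dist (x z) (x t + (z - t) • v (x t)) := infDist_le_infDist_add_dist
    rw [dist_eq_norm, ← sub_sub] at h5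
    rw [Real.norm_of_nonneg hzt.le] at hz1
    rw [inv_mul_lt_iff₀ hzt]
    have h6 : (L : ℝ) * infDist (x t) K + δ < r := by
      rw [hδ]
      linarith [show (L : ℝ) * infDist (x t) K < r from hr]
    nlinarith

/-- Radial retraction onto the ball of radius `R`. -/
def truncate (R : ℝ) (x : E) : E := (R / max R ‖x‖) • x

theorem truncate_of_norm_le {R : ℝ} (hR : 0 < R) {x : E} (hx : ‖x‖ ≤ R) : truncate R x = x := by
  rw [truncate, max_eq_left hx, div_self hR.ne', one_smul]

theorem norm_truncate_le {R : ℝ} (hR : 0 < R) (x : E) : ‖truncate R x‖ ≤ R := by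
  have hm : 0 < max R ‖x‖ := lt_max_of_lt_left hR
  rw [truncate, norm_smul, Real.norm_of_nonneg (by positivity), div_mul_eq_mul_div,
    div_le_iff₀ hm]
  gcongr
  exact le_max_right _ _

/-- The difference splits into the scaled difference of the arguments and the difference of the
scaling factors times `y`. Each is at most `‖x - y‖`, whence the constant 2, valid in any normed
space. -/
theorem lipschitzWith_truncate {R : ℝ} (hR : 0 < R) : LipschitzWith 2 (truncate R : E → E) := by
  refine LipschitzWith.of_dist_le_mul fun x y => ?_
  have hx : 0 < max R ‖x‖ := lt_max_of_lt_left hR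
  have hy : 0 < max R ‖y‖ := lt_max_of_lt_left hR
  have h1 : R / max R ‖x‖ ≤ 1 := (div_le_one hx).mpr (le_max_left _ _)
  have h2 : ‖y‖ / max R ‖y‖ ≤ 1 := (div_le_one hy).mpr (le_max_right _ _)
  have h3 : |max R ‖y‖ - max R ‖x‖| ≤ ‖x - y‖ := by
    refine (abs_max_sub_max_le_max _ _ _ _).trans ?_
    rw [sub_self, abs_zero, max_eq_right (abs_nonneg _), abs_sub_comm]
    exact abs_norm_sub_norm_le x y
  have h4 : truncate R x - truncate R y
      = (R / max R ‖x‖) • (x - y) + (R / max R ‖x‖ - R / max R ‖y‖) • y := by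
    simp only [truncate, smul_sub, sub_smul]; abel
  have h5 : ‖(R / max R ‖x‖ - R / max R ‖y‖) • y‖ ≤ ‖x - y‖ := by
    have : R / max R ‖x‖ - R / max R ‖y‖
        = (max R ‖y‖ - max R ‖x‖) * (R / max R ‖x‖) * (1 / max R ‖y‖) := by
      field_simp
    rw [norm_smul, this, Real.norm_eq_abs, abs_mul, abs_mul,
      abs_of_nonneg (by positivity : 0 ≤ R / max R ‖x‖),
      abs_of_nonneg (by positivity : 0 ≤ 1 / max R ‖y‖)]
    calc _ = |max R ‖y‖ - max R ‖x‖| * ((R / max R ‖x‖) * (‖y‖ / max R ‖y‖)) := by ring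
      _ ≤ ‖x - y‖ * (1 * 1) := by gcongr
      _ = ‖x - y‖ := by ring
  rw [dist_eq_norm, h4, dist_eq_norm]
  refine (norm_add_le _ _).trans ?_
  rw [norm_smul, Real.norm_of_nonneg (by positivity : 0 ≤ R / max R ‖x‖)]
  calc _ ≤ 1 * ‖x - y‖ + ‖x - y‖ := by gcongr
    _ = _ := by push_cast; ring

theorem lipschitzWith_comp_truncate {v : E → E} {R : ℝ} (hR : 0 < R) {L : ℝ≥0}
    (hv : LipschitzOnWith L v (closedBall 0 R)) :
    LipschitzWith (L * 2) (fun x => v (truncate R x)) := by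
  rw [← lipschitzOnWith_univ]
  exact hv.comp ((lipschitzWith_truncate hR).lipschitzOnWith) fun x _ => by
    simpa using norm_truncate_le hR x

/-- Positive invariance for locally Lipschitz vector fields. -/
theorem mem_of_hasDerivWithinAt_Ici {v : E → E}
    (hv : ∀ R, ∃ L : ℝ≥0, LipschitzOnWith L v (closedBall 0 R)) {K : Set E}
    (hK : Convex ℝ K) (hKc : IsClosed K) {R₀ : ℝ} (hKb : ∀ x ∈ K, ‖x‖ ≤ R₀) {c : ℝ} (hc : 0 < c)
    (hvK : ∀ x ∈ K, x + c⁻¹ • v x ∈ K) {x : ℝ → E}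
    (hx : ∀ t, 0 ≤ t → HasDerivWithinAt x (v (x t)) (Ici 0) t) (h0 : x 0 ∈ K) {t : ℝ}
    (ht : 0 ≤ t) : x t ∈ K := by
  have hcont : ContinuousOn x (Icc 0 t) := fun s hs =>
    ((hx s hs.1).continuousWithinAt).mono Icc_subset_Ici_self
  obtain ⟨R₁, hR₁⟩ := isCompact_Icc.exists_bound_of_continuousOn hcont
  -- The truncation must be the identity on `K` and along the given trajectory up to time `t`; the 1
  -- only makes the radius positive.
  set R := max (max R₀ R₁) 1
  have hR : 0 < R := lt_max_of_lt_right one_pos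
  obtain ⟨L, hL⟩ := hv R
  refine mem_of_hasDerivWithinAt (lipschitzWith_comp_truncate hR hL) hK hKc hc ?_ hcont ?_ h0 t
    ⟨ht, le_rfl⟩
  · intro y hy
    rw [truncate_of_norm_le hR ((hKb y hy).trans ((le_max_left _ _).trans (le_max_left _ _)))]
    exact hvK y hy
  · intro s hs
    rw [truncate_of_norm_le hR ((hR₁ s ⟨hs.1, hs.2.le⟩).trans
      ((le_max_right _ _).trans (le_max_left _ _)))]
    exact (hx s hs.1).mono (Ici_subset_Ici.mpr hs.1)

/-! ### Global existence of solutions -/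

variable [CompleteSpace E]

/-- For a field bounded by `M`, the Picard–Lindelöf ball may have radius `M * T`, so no smallness of
`T` is required. -/
theorem exists_hasDerivWithinAt_Icc {v : E → E} {L M : ℝ≥0} (hv : LipschitzWith L v)
    (hb : ∀ x, ‖v x‖ ≤ M) (x₀ : E) {T : ℝ} (hT : 0 ≤ T) :
    ∃ x : ℝ → E, x 0 = x₀ ∧ ∀ t ∈ Icc 0 T, HasDerivWithinAt x (v (x t)) (Icc 0 T) t := by
  have h : IsPicardLindelof (fun _ => v) (⟨0, le_rfl, hT⟩ : Icc 0 T) x₀ (M * T.toNNReal) 0 M L := by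
    refine IsPicardLindelof.of_time_independent (fun x _ => hb x) hv.lipschitzOnWith ?_
    simp [hT]
  exact h.exists_eq_forall_mem_Icc_hasDerivWithinAt₀

/-- The solutions on `[0, n]` agree on common intervals by uniqueness and are glued together. -/
theorem exists_hasDerivWithinAt_Ici {v : E → E} {L M : ℝ≥0} (hv : LipschitzWith L v)
    (hb : ∀ x, ‖v x‖ ≤ M) (x₀ : E) :
    ∃ x : ℝ → E, x 0 = x₀ ∧ ∀ t, 0 ≤ t → HasDerivWithinAt x (v (x t)) (Ici 0) t := by
  choose y hy0 hy using fun n : ℕ => exists_hasDerivWithinAt_Icc hv hb x₀ (Nat.cast_nonneg n)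
  have huniq : ∀ m n : ℕ, m ≤ n → EqOn (y m) (y n) (Icc 0 (m : ℝ)) := by
    intro m n hmn
    have hmn' : (m : ℝ) ≤ n := Nat.cast_le.mpr hmn
    have hder : ∀ k : ℕ, m ≤ k → ∀ t ∈ Ico 0 (m : ℝ),
        HasDerivWithinAt (y k) (v (y k t)) (Ici t) t := by
      intro k hk t ht
      have hmk : (m : ℝ) ≤ k := Nat.cast_le.mpr hk
      refine (hy k t ⟨ht.1, ht.2.le.trans hmk⟩).mono_of_mem_nhdsWithin ?_
      refine mem_of_superset (Icc_mem_nhdsGE (ht.2.trans_le hmk)) ?_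
      exact Icc_subset_Icc_left ht.1
    refine ODE_solution_unique (v := fun _ => v) (K := L) (fun _ => hv)
      (fun t ht => (hy m t ht).continuousWithinAt) (hder m le_rfl)
      (fun t ht => ((hy n t ⟨ht.1, ht.2.trans hmn'⟩).continuousWithinAt).mono
        (Icc_subset_Icc_right hmn')) (hder n hmn) ((hy0 m).trans (hy0 n).symm)
  have hy' : ∀ (n : ℕ) (s : ℝ), 0 ≤ s → s ≤ n → y (⌈s⌉₊ + 1) s = y n s := by
    intro n s hs hsn
    have hs1 : s ≤ ((⌈s⌉₊ + 1 : ℕ) : ℝ) := by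
      push_cast; linarith [Nat.le_ceil s]
    rcases le_total (⌈s⌉₊ + 1) n with h | h
    · exact huniq _ _ h ⟨hs, hs1⟩
    · exact (huniq _ _ h ⟨hs, hsn⟩).symm
  -- The extra 1 puts `t` strictly below the right endpoint, so that a derivative within `Icc 0 n`
  -- is one within `Ici 0`.
  refine ⟨fun t => y (⌈t⌉₊ + 1) t, by simp [hy0], fun t ht => ?_⟩
  set n := ⌈t⌉₊ + 1 with hn
  have htn : t < n := by rw [hn]; push_cast; linarith [Nat.le_ceil t]
  have h1 : HasDerivWithinAt (fun t => y (⌈t⌉₊ + 1) t) (v (y n t)) (Icc 0 (n : ℝ)) t :=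
    (hy n t ⟨ht, htn.le⟩).congr (fun s hs => hy' n s hs.1 hs.2) rfl
  refine h1.mono_of_mem_nhdsWithin ?_
  rw [← Ici_inter_Iic]
  exact inter_mem self_mem_nhdsWithin (nhdsWithin_le_nhds (Iic_mem_nhds htn))

/-- Global existence for locally Lipschitz vector fields with a bounded invariant set. -/
theorem exists_hasDerivWithinAt_Ici_of_mem {v : E → E}
    (hv : ∀ R, ∃ L : ℝ≥0, LipschitzOnWith L v (closedBall 0 R)) {K : Set E}
    (hK : Convex ℝ K) (hKc : IsClosed K) {R₀ : ℝ} (hKb : ∀ x ∈ K, ‖x‖ ≤ R₀) {c : ℝ} (hc : 0 < c)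
    (hvK : ∀ x ∈ K, x + c⁻¹ • v x ∈ K) {x₀ : E} (h0 : x₀ ∈ K) :
    ∃ x : ℝ → E, x 0 = x₀ ∧ ∀ t, 0 ≤ t → HasDerivWithinAt x (v (x t)) (Ici 0) t := by
  set R := max R₀ 1
  have hR : 0 < R := lt_max_of_lt_right one_pos
  obtain ⟨L, hL⟩ := hv R
  have hL' := lipschitzWith_comp_truncate hR hL
  have htr : ∀ x ∈ K, truncate R x = x := fun x hx =>
    truncate_of_norm_le hR ((hKb x hx).trans (le_max_left _ _))
  have hb : ∀ x, ‖v (truncate R x)‖ ≤ (⟨‖v 0‖ + L * R, by positivity⟩ : ℝ≥0) := by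
    intro x
    have h1 := hL.dist_le_mul (truncate R x) (by simpa using norm_truncate_le hR x) 0
      (by simpa using hR.le)
    rw [dist_eq_norm, dist_zero_right] at h1
    have h2 : ‖v (truncate R x)‖ ≤ ‖v 0‖ + ‖v (truncate R x) - v 0‖ := by
      simpa using norm_add_le (v 0) (v (truncate R x) - v 0)
    refine h2.trans ?_
    change _ ≤ ‖v 0‖ + L * R
    gcongr
    refine h1.trans ?_
    gcongr
    exact norm_truncate_le hR x
  obtain ⟨x, hx0, hx⟩ := exists_hasDerivWithinAt_Ici hL' hb x₀
  refine ⟨x, hx0, fun t ht => ?_⟩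
  -- The solution of the truncated equation never leaves `K`, where the truncation does nothing; so
  -- it solves the original equation.
  have hmem : x t ∈ K := by
    refine mem_of_hasDerivWithinAt hL' hK hKc hc (fun y hy => ?_) (T := t)
      (fun s hs => ((hx s hs.1).continuousWithinAt).mono Icc_subset_Ici_self)
      (fun s hs => (hx s hs.1).mono (Ici_subset_Ici.mpr hs.1)) (hx0 ▸ h0) t ⟨ht, le_rfl⟩
    rw [htr y hy]
    exact hvK y hy
  simpa only [htr _ hmem] using hx t ht

end Invariance

/-! ### Bounded test functions and adjoint operators -/

/-- `φ` is measurable and bounded by `K`. -/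
structure IsTest {X : Type*} [MeasurableSpace X] (φ : X → ℝ) (K : ℝ) : Prop where
  measurable : Measurable φ
  abs_le : ∀ x, |φ x| ≤ K

theorem IsTest.comp {X Y : Type*} [MeasurableSpace X] [MeasurableSpace Y] {φ : X → ℝ} {K : ℝ}
    (h : IsTest φ K) {T : Y → X} (hT : Measurable T) : IsTest (fun y => φ (T y)) K :=
  ⟨h.measurable.comp hT, fun _ => h.abs_le _⟩

theorem IsTest.nonneg {X : Type*} [MeasurableSpace X] [Nonempty X] {φ : X → ℝ} {K : ℝ}
    (h : IsTest φ K) : 0 ≤ K :=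
  (abs_nonneg _).trans (h.abs_le (Classical.arbitrary X))

theorem IsTest.integrable_mul {X : Type*} [MeasurableSpace X] {μ : Measure X} {φ f : X → ℝ}
    {K : ℝ} (h : IsTest φ K) (hf : Integrable f μ) : Integrable (fun x => f x * φ x) μ :=
  hf.mul_bdd (c := K) h.measurable.aestronglyMeasurable (Eventually.of_forall h.abs_le)

theorem IsTest.abs_integral_mul_le {X : Type*} [MeasurableSpace X] {μ : Measure X} {φ f : X → ℝ}
    {K : ℝ} (h : IsTest φ K) (hf : Integrable f μ) :
    |∫ x, f x * φ x ∂μ| ≤ K * ∫ x, ‖f x‖ ∂μ := by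
  rw [← integral_const_mul, ← Real.norm_eq_abs]
  refine norm_integral_le_of_norm_le (hf.norm.const_mul K) (Eventually.of_forall fun x => ?_)
  rw [norm_mul, mul_comm]
  exact mul_le_mul_of_nonneg_right (h.abs_le _) (norm_nonneg _)

/-- Averaging against a probability density preserves the bound `K`. Both adjoint operators are of
this form, so `K` stays the same through all levels of the hierarchy. -/
theorem IsTest.integral {X Y : Type*} [MeasurableSpace X] [MeasurableSpace Y] {ν : Measure Y}
    [SFinite ν] {φ : X × Y → ℝ} {K : ℝ} (h : IsTest φ K) {k : Y → ℝ} (hk : Measurable k)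
    (hk0 : ∀ y, 0 ≤ k y) (hki : Integrable k ν) (hk1 : ∫ y, k y ∂ν = 1) :
    IsTest (fun x => ∫ y, k y * φ (x, y) ∂ν) K := by
  refine ⟨?_, fun x => ?_⟩
  · have h1 : Measurable fun p : X × Y => k p.2 * φ p :=
      (hk.comp measurable_snd).mul h.measurable
    exact h1.stronglyMeasurable.integral_prod_right'.measurable
  · have := (h.comp (measurable_prodMk_left (x := x))).abs_integral_mul_le hki
    refine this.trans (le_of_eq ?_)
    simp_rw [Real.norm_of_nonneg (hk0 _), hk1, mul_one]

theorem integral_angle (h : ℝ → ℝ) :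
    ∫ θ, h θ ∂angle = (2 * Real.pi)⁻¹ * ∫ θ in (0 : ℝ)..(2 * Real.pi), h θ := by
  rw [angle, integral_smul_measure, intervalIntegral.integral_of_le (by positivity),
    ENNReal.toReal_ofReal (by positivity), smul_eq_mul]

theorem integral_angle_neg {h : ℝ → ℝ} (hh : Function.Periodic h (2 * Real.pi)) :
    ∫ θ, h (-θ) ∂angle = ∫ θ, h θ ∂angle := by
  rw [integral_angle, integral_angle, intervalIntegral.integral_comp_neg, neg_zero]
  congr 1
  have := hh.intervalIntegral_add_eq (-(2 * Real.pi)) 0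
  simpa using this

/-! ### Duality for the collision operator -/

theorem measurable_rotate {n : ℕ} {i j : Fin n} (hij : i ≠ j) :
    Measurable fun p : ℝ × (Fin n → ℝ) => rotate i j p.1 p.2 := by
  refine measurable_pi_lambda _ fun l => ?_
  simp only [rotate_apply hij]
  split_ifs <;> fun_prop

theorem measurable_rotate_neg {n : ℕ} {i j : Fin n} (hij : i ≠ j) :
    Measurable fun p : ℝ × (Fin n → ℝ) => rotate i j (-p.1) p.2 :=
  (measurable_rotate hij).comp (measurable_fst.neg.prodMk measurable_snd)

theorem rotate_neg_rotate {n : ℕ} {i j : Fin n} (hij : i ≠ j) (θ : ℝ) (v : Fin n → ℝ) :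
    rotate i j (-θ) (rotate i j θ v) = v := by
  have h := Real.sin_sq_add_cos_sq θ
  funext l
  simp only [rotate_apply hij, Real.cos_neg, Real.sin_neg, if_true, hij.symm, if_false]
  split_ifs with h1 h2
  · subst h1; linear_combination v l * h
  · subst h2; linear_combination v l * h
  · rfl

theorem rotate_symm {n : ℕ} {i j : Fin n} (hij : i ≠ j) (θ : ℝ) :
    rotate j i θ = rotate i j (-θ) := by
  funext v l
  simp only [rotate_apply hij, rotate_apply hij.symm, Real.cos_neg, Real.sin_neg]
  split_ifs with h1 h2 h2
  · exact absurd (h2.symm.trans h1) hij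
  · ring
  · ring
  · rfl

theorem rotate_periodic {n : ℕ} (i j : Fin n) (v : Fin n → ℝ) :
    Function.Periodic (fun θ => rotate i j θ v) (2 * Real.pi) := fun θ => by
  simp only [rotate, Real.cos_add_two_pi, Real.sin_add_two_pi]

/-- The adjoint of `collisionOp i j`. -/
def collisionDual {n : ℕ} (i j : Fin n) (ψ : (Fin n → ℝ) → ℝ) (v : Fin n → ℝ) : ℝ :=
  ∫ θ, ψ (rotate i j (-θ) v) ∂angle

/-- Exchanging the two particles reverses the angle, and the uniform law of the angle is invariant
under reversal. -/
theorem collisionDual_symm {n : ℕ} {i j : Fin n} (hij : i ≠ j) (ψ : (Fin n → ℝ) → ℝ) :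
    collisionDual j i ψ = collisionDual i j ψ := by
  funext v
  simp only [collisionDual, rotate_symm hij, neg_neg]
  refine (integral_angle_neg (h := fun θ => ψ (rotate i j θ v)) fun θ => ?_).symm
  exact congrArg ψ (rotate_periodic i j v θ)

theorem IsTest.collisionDual {n : ℕ} {i j : Fin n} (hij : i ≠ j) {ψ : (Fin n → ℝ) → ℝ} {K : ℝ}
    (h : IsTest ψ K) : IsTest (collisionDual i j ψ) K := by
  have h1 : IsTest (fun p : (Fin n → ℝ) × ℝ => ψ (rotate i j (-p.2) p.1)) K :=
    (h.comp (measurable_rotate_neg hij)).comp measurable_swap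
  have := h1.integral (ν := angle) (k := fun _ => 1) measurable_const (fun _ => zero_le_one)
    (integrable_const _) (by simp)
  simp only [one_mul] at this
  exact this

/-- After Fubini, for each fixed angle, this is the substitution `v ↦ rotate i j θ v`, which
preserves volume. -/
theorem integral_mul_collisionDual {n : ℕ} {i j : Fin n} (hij : i ≠ j) {F ψ : (Fin n → ℝ) → ℝ}
    {K : ℝ} (hF : Integrable F) (hψ : IsTest ψ K) :
    ∫ v, F v * collisionDual i j ψ v = ∫ v, (∫ θ, F (rotate i j θ v) ∂angle) * ψ v := by
  have h1 : Integrable (fun p : ℝ × (Fin n → ℝ) => F p.2 * ψ (rotate i j (-p.1) p.2))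
      (angle.prod volume) :=
    (hψ.comp (measurable_rotate_neg hij)).integrable_mul (hF.comp_snd angle)
  have h2 : Integrable (fun p : ℝ × (Fin n → ℝ) => F (rotate i j p.1 p.2) * ψ p.2)
      (angle.prod volume) := by
    refine (hψ.comp measurable_snd).integrable_mul ?_
    simpa only [one_mul] using (isAveraging_rotate hij).integrable F hF
  simp only [collisionDual, ← integral_const_mul, ← integral_mul_const]
  rw [← integral_prod_symm _ h1, integral_prod _ h1, ← integral_prod_symm _ h2, integral_prod _ h2]
  congr 1
  funext θ
  have hmp := measurePreserving_rotate hij θ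
  have hm : AEStronglyMeasurable (fun v => F v * ψ (rotate i j (-θ) v))
      (volume.map (rotate i j θ)) := by
    rw [hmp.map_eq]
    exact ((hψ.comp ((measurable_rotate_neg hij).comp
      (measurable_prodMk_left (x := θ)))).integrable_mul hF).aestronglyMeasurable
  have := integral_map hmp.aemeasurable hm
  rw [hmp.map_eq] at this
  simpa only [rotate_neg_rotate hij] using this

theorem integral_collisionOp {n : ℕ} {i j : Fin n} (hij : i ≠ j) (F : L1 n)
    {ψ : (Fin n → ℝ) → ℝ} {K : ℝ} (hψ : IsTest ψ K) :
    ∫ v, collisionOp i j hij F v * ψ v = ∫ v, F v * collisionDual i j ψ v := by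
  rw [integral_mul_collisionDual hij (L1.integrable_coeFn F) hψ]
  refine integral_congr_ae ?_
  have : collisionOp i j hij F =ᵐ[volume] avg angle (fun _ => 1)
      (fun p => rotate i j p.1 p.2) F :=
    Integrable.coeFn_toL1 ((isAveraging_rotate hij).integrable_avg (L1.integrable_coeFn F))
  filter_upwards [this] with v hv
  rw [hv]
  simp only [avg, one_mul]

/-! ### Duality for the thermostat -/

theorem measurable_gauss (β : ℝ) : Measurable (gauss β) :=
  ProbabilityTheory.measurable_gaussianPDFReal _ _

theorem integrable_gauss (β : ℝ) : Integrable (gauss β) :=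
  ProbabilityTheory.integrable_gaussianPDFReal _ _

theorem gauss_nonneg (β x : ℝ) : 0 ≤ gauss β x := ProbabilityTheory.gaussianPDFReal_nonneg _ _ _

theorem integral_gauss {β : ℝ} (hβ : 0 < β) : ∫ x, gauss β x = 1 :=
  ProbabilityTheory.integral_gaussianPDFReal_eq_one _ (by simpa using hβ)

/-- The adjoint of `thermostatOp β i`. -/
def thermostatDual {n : ℕ} (β : ℝ) (i : Fin n) (ψ : (Fin n → ℝ) → ℝ) (v : Fin n → ℝ) : ℝ :=
  ∫ w, gauss β w * ψ (Function.update v i w)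

theorem measurable_update_snd {n : ℕ} (i : Fin n) :
    Measurable fun p : (Fin n → ℝ) × ℝ => Function.update p.1 i p.2 := by
  refine measurable_pi_lambda _ fun l => ?_
  by_cases h : l = i
  · subst h; simpa using measurable_snd
  · simp only [Function.update_of_ne h]; fun_prop

theorem IsTest.thermostatDual {n : ℕ} {β : ℝ} (hβ : 0 < β) (i : Fin n) {ψ : (Fin n → ℝ) → ℝ}
    {K : ℝ} (h : IsTest ψ K) : IsTest (thermostatDual β i ψ) K :=
  (h.comp (measurable_update_snd i)).integral (measurable_gauss β) (gauss_nonneg β)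
    (integrable_gauss β) (integral_gauss hβ)

/-- Both sides are integrals over `(w, v)`, carried into each other by the measure-preserving
exchange of `w` and `v i`. -/
theorem integral_mul_thermostatDual {n : ℕ} (β : ℝ) (i : Fin n) {F ψ : (Fin n → ℝ) → ℝ}
    {K : ℝ} (hF : Integrable F) (hψ : IsTest ψ K) :
    ∫ v, F v * thermostatDual β i ψ v =
      ∫ v, (∫ w, gauss β (v i) * F (Function.update v i w)) * ψ v := by
  have hu : Measurable fun p : ℝ × (Fin n → ℝ) => Function.update p.2 i p.1 :=
    (measurable_update_snd i).comp measurable_swap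
  have h1 : Integrable (fun p : ℝ × (Fin n → ℝ) =>
      gauss β p.1 * F p.2 * ψ (Function.update p.2 i p.1)) (volume.prod volume) :=
    (hψ.comp hu).integrable_mul ((integrable_gauss β).mul_prod hF)
  have h2 : Integrable (fun p : ℝ × (Fin n → ℝ) =>
      gauss β (p.2 i) * F (Function.update p.2 i p.1) * ψ p.2) (volume.prod volume) :=
    (hψ.comp measurable_snd).integrable_mul ((isAveraging_thermostat β i).integrable F hF)
  have e1 : ∫ v, F v * thermostatDual β i ψ v
      = ∫ v, ∫ w, gauss β w * F v * ψ (Function.update v i w) := by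
    simp only [thermostatDual, ← integral_const_mul]
    congr! 4
    ring
  rw [e1]
  simp only [← integral_mul_const]
  rw [← integral_prod_symm _ h1, ← integral_prod_symm _ h2]
  have hmp := measurePreserving_exchange i
  have hm := h1.aestronglyMeasurable
  rw [← hmp.map_eq] at hm
  have := integral_map hmp.aemeasurable hm
  rw [hmp.map_eq] at this
  simpa using this

theorem integral_thermostatOp {n : ℕ} (β : ℝ) (i : Fin n) (F : L1 n)
    {ψ : (Fin n → ℝ) → ℝ} {K : ℝ} (hψ : IsTest ψ K) :
    ∫ v, thermostatOp β i F v * ψ v = ∫ v, F v * thermostatDual β i ψ v := by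
  rw [integral_mul_thermostatDual β i (L1.integrable_coeFn F) hψ]
  refine integral_congr_ae ?_
  have : thermostatOp β i F =ᵐ[volume] avg volume (fun p => gauss β (p.2 i))
      (fun p => Function.update p.2 i p.1) F :=
    Integrable.coeFn_toL1 ((isAveraging_thermostat β i).integrable_avg (L1.integrable_coeFn F))
  filter_upwards [this] with v hv
  rw [hv]
  rfl

/-! ### The gain operator on `L¹(ℝ)` -/

/-- The collision of two velocities. -/
def collidePair (p : ℝ × (ℝ × ℝ)) : ℝ × ℝ :=
  (p.2.1 * Real.cos p.1 - p.2.2 * Real.sin p.1, p.2.1 * Real.sin p.1 + p.2.2 * Real.cos p.1)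

theorem measurePreserving_collidePair :
    MeasurePreserving collidePair (angle.prod (volume : Measure (ℝ × ℝ))) volume := by
  have h01 : (0 : Fin 2) ≠ 1 := by decide
  have hE := volume_preserving_finTwoArrow ℝ
  have hm : Measurable (Function.uncurry fun (θ : ℝ) (p : ℝ × ℝ) => collidePair (θ, p)) := by
    change Measurable fun q : ℝ × (ℝ × ℝ) => collidePair q
    unfold collidePair
    fun_prop
  have h := (MeasurePreserving.id angle).skew_product (μc := (volume : Measure (ℝ × ℝ)))
    (μd := volume) hm (Eventually.of_forall fun θ => ?_)
  · exact measurePreserving_snd.comp h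
  · have h1 := (hE.comp (measurePreserving_rotate h01 θ)).comp hE.symm
    convert h1.map_eq using 2
    funext p
    simp [collidePair, rotate_apply h01, MeasurableEquiv.finTwoArrow]

theorem isAveraging_collidePair :
    IsAveraging angle (volume : Measure (ℝ × ℝ)) (fun _ => 1) collidePair 1 := by
  have hmp := measurePreserving_collidePair
  constructor
  · intro f hf
    simp only [one_mul]
    exact hmp.integrable_comp_of_integrable hf
  · intro f hf
    simp only [one_mul]
    have hf' : AEStronglyMeasurable (fun x => ‖f x‖)
        ((angle.prod volume).map collidePair) := by
      rw [hmp.map_eq]; exact hf.norm.aestronglyMeasurable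
    have := integral_map hmp.aemeasurable hf'
    rw [hmp.map_eq] at this
    exact this.symm.le

/-- The first marginal of a collided pair density. -/
def pairGain (F : ℝ × ℝ → ℝ) (v : ℝ) : ℝ := ∫ w, avg angle (fun _ => 1) collidePair F (v, w)

/-- The bilinear gain term is a linear averaging operator applied to the tensor product of `f` and
`h`; integrability, mass and norm bounds are inherited from that operator. -/
theorem gain_eq_pairGain (f h : ℝ → ℝ) : gain f h = pairGain fun p => f p.1 * h p.2 := by
  funext v
  simp only [gain, pairGain, avg, ← integral_angle, collidePair, one_mul]

theorem gain_apply (f h : ℝ → ℝ) (v : ℝ) :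
    gain f h v = ∫ w, ∫ θ, f (v * Real.cos θ - w * Real.sin θ) *
      h (v * Real.sin θ + w * Real.cos θ) ∂angle := by
  simp only [gain, ← integral_angle]

theorem integrable_pairGain {F : ℝ × ℝ → ℝ} (hF : Integrable F) : Integrable (pairGain F) :=
  (isAveraging_collidePair.integrable_avg hF).integral_prod_left

theorem pairGain_congr {F G : ℝ × ℝ → ℝ} (hF : Integrable F) (hG : Integrable G)
    (h : F =ᵐ[volume] G) : pairGain F =ᵐ[volume] pairGain G := by
  have h1 := Measure.ae_ae_of_ae_prod (isAveraging_collidePair.avg_congr hF hG h)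
  filter_upwards [h1] with v hv
  exact integral_congr_ae hv

theorem pairGain_add {F G : ℝ × ℝ → ℝ} (hF : Integrable F) (hG : Integrable G) :
    pairGain (F + G) =ᵐ[volume] pairGain F + pairGain G := by
  have h1 := Measure.ae_ae_of_ae_prod (isAveraging_collidePair.avg_add hF hG)
  filter_upwards [h1, (isAveraging_collidePair.integrable_avg hF).prod_right_ae,
    (isAveraging_collidePair.integrable_avg hG).prod_right_ae] with v hv hv1 hv2
  rw [Pi.add_apply, pairGain, integral_congr_ae hv]
  exact integral_add hv1 hv2

theorem pairGain_smul (c : ℝ) (F : ℝ × ℝ → ℝ) : pairGain (c • F) = c • pairGain F := by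
  funext v
  simp only [pairGain, avg_smul, Pi.smul_apply, smul_eq_mul, integral_const_mul]

theorem pairGain_nonneg {F : ℝ × ℝ → ℝ} (h : ∀ p, 0 ≤ F p) (v : ℝ) : 0 ≤ pairGain F v :=
  integral_nonneg fun w => integral_nonneg fun θ => by simpa using h _

theorem integral_pairGain {F : ℝ × ℝ → ℝ} (hF : Integrable F) :
    ∫ v, pairGain F v = ∫ p, F p := by
  have h1 : ∫ v, pairGain F v = ∫ q, avg angle (fun _ => 1) collidePair F q :=
    (integral_prod _ (isAveraging_collidePair.integrable_avg hF)).symm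
  have hi := isAveraging_collidePair.integrable F hF
  rw [h1]
  simp only [avg]
  rw [← integral_prod_symm _ hi]
  simp only [one_mul]
  have hmp := measurePreserving_collidePair
  have hf' : AEStronglyMeasurable F ((angle.prod volume).map collidePair) := by
    rw [hmp.map_eq]; exact hF.aestronglyMeasurable
  have := integral_map hmp.aemeasurable hf'
  rw [hmp.map_eq] at this
  exact this.symm

theorem norm_pairGain_le {F : ℝ × ℝ → ℝ} (hF : Integrable F) :
    ∫ v, ‖pairGain F v‖ ≤ ∫ p, ‖F p‖ := by
  have h1 := isAveraging_collidePair.norm_avg hF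
  rw [one_mul] at h1
  refine le_trans ?_ h1
  have hi := isAveraging_collidePair.integrable_avg hF
  have h2 : ∫ q, ‖avg angle (fun _ => 1) collidePair F q‖ =
      ∫ v, ∫ w, ‖avg angle (fun _ => 1) collidePair F (v, w)‖ := integral_prod _ hi.norm
  rw [h2]
  refine integral_mono (integrable_pairGain hF).norm hi.norm.integral_prod_left fun v => ?_
  exact norm_integral_le_integral_norm _

theorem integrable_gain {f h : ℝ → ℝ} (hf : Integrable f) (hh : Integrable h) :
    Integrable (gain f h) := by
  rw [gain_eq_pairGain]
  exact integrable_pairGain (hf.mul_prod hh)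

theorem integral_gain {f h : ℝ → ℝ} (hf : Integrable f) (hh : Integrable h) :
    ∫ v, gain f h v = (∫ v, f v) * ∫ v, h v := by
  rw [gain_eq_pairGain, integral_pairGain (hf.mul_prod hh)]
  exact integral_prod_mul f h

theorem gain_congr {f f' h h' : ℝ → ℝ} (hf : Integrable f) (hf' : Integrable f')
    (hh : Integrable h) (hh' : Integrable h') (e1 : f =ᵐ[volume] f') (e2 : h =ᵐ[volume] h') :
    gain f h =ᵐ[volume] gain f' h' := by
  rw [gain_eq_pairGain, gain_eq_pairGain]
  refine pairGain_congr (hf.mul_prod hh) (hf'.mul_prod hh') ?_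
  have h1 : ∀ᵐ p : ℝ × ℝ, f p.1 = f' p.1 := Measure.quasiMeasurePreserving_fst.ae e1
  have h2 : ∀ᵐ p : ℝ × ℝ, h p.2 = h' p.2 := Measure.quasiMeasurePreserving_snd.ae e2
  filter_upwards [h1, h2] with p hp1 hp2
  rw [hp1, hp2]

/-- The gain term as a bounded bilinear operator on `L¹(ℝ)`. -/
def gainOp : L1R →L[ℝ] L1R →L[ℝ] L1R :=
  LinearMap.mkContinuous₂
    (LinearMap.mk₂ ℝ
      (fun f h => (integrable_gain (L1.integrable_coeFn f) (L1.integrable_coeFn h)).toL1 (gain f h))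
      (fun f g h => by
        have hf := L1.integrable_coeFn f
        have hg := L1.integrable_coeFn g
        have hh := L1.integrable_coeFn h
        rw [← Integrable.toL1_add, Integrable.toL1_eq_toL1_iff]
        refine (gain_congr (L1.integrable_coeFn _) (hf.add hg) hh hh (Lp.coeFn_add f g)
          (EventuallyEq.refl _ _)).trans ?_
        simp only [gain_eq_pairGain]
        refine EventuallyEq.trans (EventuallyEq.of_eq (congrArg _ ?_))
          (pairGain_add (hf.mul_prod hh) (hg.mul_prod hh))
        funext p
        simp only [Pi.add_apply, add_mul])
      (fun c f h => by
        have hf := L1.integrable_coeFn f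
        have hh := L1.integrable_coeFn h
        rw [← Integrable.toL1_smul, Integrable.toL1_eq_toL1_iff]
        refine (gain_congr (L1.integrable_coeFn _) (hf.smul c) hh hh (Lp.coeFn_smul c f)
          (EventuallyEq.refl _ _)).trans (EventuallyEq.of_eq ?_)
        rw [gain_eq_pairGain, gain_eq_pairGain]
        refine Eq.trans ?_ (pairGain_smul c fun p => f p.1 * h p.2)
        congr 1
        funext p
        simp only [Pi.smul_apply, smul_eq_mul, mul_assoc])
      (fun f g h => by
        have hf := L1.integrable_coeFn f
        have hg := L1.integrable_coeFn g
        have hh := L1.integrable_coeFn h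
        rw [← Integrable.toL1_add, Integrable.toL1_eq_toL1_iff]
        refine (gain_congr hf hf (L1.integrable_coeFn _) (hg.add hh) (EventuallyEq.refl _ _)
          (Lp.coeFn_add g h)).trans ?_
        simp only [gain_eq_pairGain]
        refine EventuallyEq.trans (EventuallyEq.of_eq (congrArg _ ?_))
          (pairGain_add (hf.mul_prod hg) (hf.mul_prod hh))
        funext p
        simp only [Pi.add_apply, mul_add])
      (fun c f h => by
        have hf := L1.integrable_coeFn f
        have hh := L1.integrable_coeFn h
        rw [← Integrable.toL1_smul, Integrable.toL1_eq_toL1_iff]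
        refine (gain_congr hf hf (L1.integrable_coeFn _) (hh.smul c) (EventuallyEq.refl _ _)
          (Lp.coeFn_smul c h)).trans (EventuallyEq.of_eq ?_)
        rw [gain_eq_pairGain, gain_eq_pairGain]
        refine Eq.trans ?_ (pairGain_smul c fun p => f p.1 * h p.2)
        congr 1
        funext p
        simp only [Pi.smul_apply, smul_eq_mul, mul_left_comm]))
    1
    (fun f h => by
      have hf := L1.integrable_coeFn f
      have hh := L1.integrable_coeFn h
      rw [one_mul, LinearMap.mk₂_apply, L1.norm_eq_integral_norm, L1.norm_eq_integral_norm,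
        L1.norm_eq_integral_norm, ← integral_prod_mul (fun v => ‖f v‖) (fun v => ‖h v‖)]
      simp only [← norm_mul]
      refine le_trans (le_of_eq (integral_congr_ae ?_)) (norm_pairGain_le (hf.mul_prod hh))
      filter_upwards [Integrable.coeFn_toL1 (integrable_gain hf hh)] with v hv
      rw [hv, gain_eq_pairGain])

theorem coeFn_gainOp (f h : L1R) : gainOp f h =ᵐ[volume] gain f h :=
  Integrable.coeFn_toL1 (integrable_gain (L1.integrable_coeFn f) (L1.integrable_coeFn h))

/-- The Gaussian `g_β` as an element of `L¹(ℝ)`. -/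
def gaussL1 (β : ℝ) : L1R := (integrable_gauss β).toL1 (gauss β)

theorem coeFn_gaussL1 (β : ℝ) : gaussL1 β =ᵐ[volume] gauss β := Integrable.coeFn_toL1 _

/-! ### Tensor products tested against bounded functions -/

/-- The integral of `(⊗ᵢ gᵢ) φ`. -/
def tens {l : ℕ} (g : Fin l → ℝ → ℝ) (φ : (Fin l → ℝ) → ℝ) : ℝ :=
  ∫ v : Fin l → ℝ, (∏ i, g i (v i)) * φ v

section Tens

variable {l : ℕ} {φ : (Fin l → ℝ) → ℝ} {K : ℝ}

theorem tens_congr {g g' : Fin l → ℝ → ℝ} (h : ∀ i, g i =ᵐ[volume] g' i) :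
    tens g φ = tens g' φ := by
  refine integral_congr_ae ?_
  have h1 : ∀ i, ∀ᵐ v : Fin l → ℝ, g i (v i) = g' i (v i) := fun i =>
    (Measure.quasiMeasurePreserving_eval (fun _ : Fin l => (volume : Measure ℝ)) i).ae
      (p := fun x => g i x = g' i x) (h i)
  filter_upwards [ae_all_iff.mpr h1] with v hv
  simp only [hv]

theorem prod_update_apply (g : Fin l → ℝ → ℝ) (i : Fin l) (h : ℝ → ℝ) (v : Fin l → ℝ) :
    ∏ j, Function.update g i h j (v j) = h (v i) * ∏ j ∈ Finset.univ.erase i, g j (v j) := by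
  rw [← Finset.mul_prod_erase _ _ (Finset.mem_univ i), Function.update_self]
  congr 1
  refine Finset.prod_congr rfl fun j hj => ?_
  rw [Function.update_of_ne (Finset.ne_of_mem_erase hj)]

theorem integrable_update {g : Fin l → ℝ → ℝ} (hg : ∀ i, Integrable (g i)) (i : Fin l)
    {h : ℝ → ℝ} (hh : Integrable h) (j : Fin l) : Integrable (Function.update g i h j) := by
  rcases eq_or_ne j i with rfl | hj
  · simpa using hh
  · simpa [hj] using hg j

theorem integrable_tens (hφ : IsTest φ K) {g : Fin l → ℝ → ℝ} (hg : ∀ i, Integrable (g i)) :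
    Integrable fun v : Fin l → ℝ => (∏ i, g i (v i)) * φ v :=
  hφ.integrable_mul (Integrable.fintype_prod hg)

theorem abs_tens_le (hφ : IsTest φ K) {g : Fin l → ℝ → ℝ} (hg : ∀ i, Integrable (g i)) :
    |tens g φ| ≤ K * ∏ i, ∫ x, ‖g i x‖ := by
  refine (hφ.abs_integral_mul_le (Integrable.fintype_prod hg)).trans (le_of_eq ?_)
  rw [← integral_fintype_prod_volume_eq_prod]
  simp only [norm_prod]
  rfl

theorem tens_update_add (hφ : IsTest φ K) {g : Fin l → ℝ → ℝ} (hg : ∀ i, Integrable (g i))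
    (i : Fin l) {x y : ℝ → ℝ} (hx : Integrable x) (hy : Integrable y) :
    tens (Function.update g i (x + y)) φ
      = tens (Function.update g i x) φ + tens (Function.update g i y) φ := by
  rw [tens, tens, tens, ← integral_add (integrable_tens hφ (integrable_update hg i hx))
    (integrable_tens hφ (integrable_update hg i hy))]
  simp only [prod_update_apply, Pi.add_apply, add_mul]

theorem tens_update_smul (g : Fin l → ℝ → ℝ) (i : Fin l) (c : ℝ) (x : ℝ → ℝ) :
    tens (Function.update g i (c • x)) φ = c * tens (Function.update g i x) φ := by
  rw [tens, tens, ← integral_const_mul]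
  simp only [prod_update_apply, Pi.smul_apply, smul_eq_mul, mul_assoc]

theorem coeFn_update (m : Fin l → L1R) (i : Fin l) (x : L1R) :
    (fun j => (Function.update m i x j : ℝ → ℝ))
      = Function.update (fun j => (m j : ℝ → ℝ)) i x := by
  funext j
  rcases eq_or_ne j i with rfl | hj
  · simp
  · simp [hj]

theorem tens_coeFn_update_congr (m : Fin l → L1R) (i : Fin l) (x : L1R) {y : ℝ → ℝ}
    (h : x =ᵐ[volume] y) :
    tens (fun j => Function.update m i x j) φ
      = tens (Function.update (fun j => (m j : ℝ → ℝ)) i y) φ := by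
  rw [coeFn_update]
  refine tens_congr fun j => ?_
  rcases eq_or_ne j i with rfl | hj
  · simpa using h
  · simp [hj]

/-- `tens` as a continuous multilinear form on `L¹(ℝ)^l`. -/
def tensL (hφ : IsTest φ K) : ContinuousMultilinearMap ℝ (fun _ : Fin l => L1R) ℝ :=
  MultilinearMap.mkContinuous
    { toFun := fun m => tens (fun i => m i) φ
      map_update_add' := fun {inst} m i x y => by
        have : inst = instDecidableEqFin l := Subsingleton.elim _ _
        subst this
        rw [tens_coeFn_update_congr m i (x + y) (Lp.coeFn_add x y), coeFn_update, coeFn_update]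
        exact tens_update_add hφ (fun j => L1.integrable_coeFn _) i (L1.integrable_coeFn _)
          (L1.integrable_coeFn _)
      map_update_smul' := fun {inst} m i c x => by
        have : inst = instDecidableEqFin l := Subsingleton.elim _ _
        subst this
        rw [tens_coeFn_update_congr m i (c • x) (Lp.coeFn_smul c x), coeFn_update]
        exact tens_update_smul _ i c x }
    K
    (fun m => by
      simp only [L1.norm_eq_integral_norm]
      exact abs_tens_le hφ fun i => L1.integrable_coeFn _)

/-- The product rule for the continuous multilinear form `tensL`: one term per slot, in which the
factor is replaced by its derivative. -/
theorem hasDerivWithinAt_tens (hφ : IsTest φ K) {g : Fin l → ℝ → L1R} {g' : Fin l → L1R}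
    {s : Set ℝ} {t : ℝ} (hg : ∀ i, HasDerivWithinAt (g i) (g' i) s t) :
    HasDerivWithinAt (fun t => tens (fun i => g i t) φ)
      (∑ i, tens (fun j => Function.update (fun i => g i t) i (g' i) j) φ) s t := by
  have h1 := ((tensL hφ).hasFDerivAt (fun i => g i t)).comp_hasDerivWithinAt t
    (hasDerivWithinAt_pi.mpr hg)
  rw [ContinuousMultilinearMap.linearDeriv_apply] at h1
  exact h1

/-- The test function on `l + 1` particles obtained by colliding particle `i` with a new one. -/
def collideNew (i : Fin l) (φ : (Fin l → ℝ) → ℝ) : (Fin (l + 1) → ℝ) → ℝ :=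
  collisionDual i.succ 0 fun u => φ fun j => u j.succ

theorem IsTest.collideNew (hφ : IsTest φ K) (i : Fin l) : IsTest (collideNew i φ) K :=
  (hφ.comp (by fun_prop)).collisionDual (Fin.succ_ne_zero i)

/-- The identity that closes the mean field hierarchy: the collision is moved from the test function
to the tensor product, and integrating out the new particle, which has index 0 and density `m`,
leaves the gain term in slot `i`. -/
theorem tens_collideNew (hφ : IsTest φ K) {g : Fin l → ℝ → ℝ} (hg : ∀ i, Integrable (g i))
    {m : ℝ → ℝ} (hm : Integrable m) (i : Fin l) :
    tens (Matrix.vecCons m g) (collideNew i φ) = tens (Function.update g i (gain (g i) m)) φ := by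
  have hi := Fin.succ_ne_zero i
  have hG : ∀ j, Integrable (Matrix.vecCons m g j) := Fin.cases hm hg
  have hF : Integrable fun u : Fin (l + 1) → ℝ => ∏ j, Matrix.vecCons m g j (u j) :=
    Integrable.fintype_prod hG
  have hψ : IsTest (fun u : Fin (l + 1) → ℝ => φ fun j => u j.succ) K := hφ.comp (by fun_prop)
  rw [tens, collideNew, integral_mul_collisionDual hi hF hψ]
  have hmp := volume_preserving_piFinSuccAbove (fun _ : Fin (l + 1) => ℝ) 0
  have hint : Integrable (fun u : Fin (l + 1) → ℝ =>
      (∫ θ, ∏ j, Matrix.vecCons m g j (rotate i.succ 0 θ u j) ∂angle) * φ fun j => u j.succ) := by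
    refine hψ.integrable_mul (((isAveraging_rotate hi).integrable_avg hF).congr
      (Eventually.of_forall fun u => ?_))
    simp only [avg, one_mul]
  -- Coordinate 0 is split off, so that Fubini can integrate over the new particle first.
  rw [← hmp.symm.integrable_comp_emb (MeasurableEquiv.measurableEmbedding _)] at hint
  rw [← hmp.symm.integral_comp']
  have e2 := integral_prod_symm _ hint
  simp only [Function.comp_def] at e2
  refine Eq.trans e2 ?_
  rw [tens]
  congr 1
  funext v
  have e3 : ∀ w : ℝ, (MeasurableEquiv.piFinSuccAbove (fun _ : Fin (l + 1) => ℝ) 0).symm (w, v)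
      = Fin.cons w v := fun w => Fin.insertNth_zero' w v
  simp only [e3, Fin.cons_succ]
  rw [integral_mul_const, prod_update_apply, gain_apply]
  refine congrArg (· * φ v) ?_
  rw [← integral_mul_const]
  congr 1
  funext w
  rw [← integral_mul_const]
  congr 1
  funext θ
  rw [Fin.prod_univ_succ, ← Finset.mul_prod_erase _ _ (Finset.mem_univ i)]
  have e4 : ∀ j ∈ Finset.univ.erase i, Matrix.vecCons m g j.succ
      (rotate i.succ 0 θ (Fin.cons w v : Fin (l + 1) → ℝ) j.succ) = g j (v j) := by
    intro j hj
    rw [rotate_apply hi]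
    simp [Finset.ne_of_mem_erase hj]
  rw [Finset.prod_congr rfl e4]
  simp only [rotate_apply hi, hi.symm, if_true, if_false, Matrix.cons_val_zero,
    Matrix.cons_val_succ, Fin.cons_zero, Fin.cons_succ]
  ring

theorem tens_thermostatDual (hφ : IsTest φ K) {g : Fin l → ℝ → ℝ} (hg : ∀ i, Integrable (g i))
    (β : ℝ) (i : Fin l) :
    tens g (thermostatDual β i φ)
      = tens (Function.update g i fun x => gauss β x * ∫ w, g i w) φ := by
  rw [tens, integral_mul_thermostatDual β i (Integrable.fintype_prod hg) hφ, tens]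
  congr 1
  funext v
  congr 1
  rw [prod_update_apply, integral_const_mul, mul_assoc, ← integral_mul_const]
  congr 2
  funext w
  rw [← Finset.mul_prod_erase _ _ (Finset.mem_univ i), Function.update_self]
  congr 1
  refine Finset.prod_congr rfl fun j hj => ?_
  rw [Function.update_of_ne (Finset.ne_of_mem_erase hj)]

end Tens

/-! ### The Boltzmann–Kac system as an ordinary differential equation -/

/-- Integration against a bounded function, as a continuous linear form on `L¹`. -/
def testL {X : Type*} [MeasurableSpace X] {μ : Measure X} {ψ : X → ℝ} {K : ℝ} (h : IsTest ψ K) :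
    Lp ℝ 1 μ →L[ℝ] ℝ :=
  LinearMap.mkContinuous
    { toFun := fun f => ∫ x, f x * ψ x ∂μ
      map_add' := fun f g => by
        rw [← integral_add (h.integrable_mul (L1.integrable_coeFn f))
          (h.integrable_mul (L1.integrable_coeFn g))]
        refine integral_congr_ae ?_
        filter_upwards [Lp.coeFn_add f g] with x hx
        rw [hx, Pi.add_apply, add_mul]
      map_smul' := fun c f => by
        rw [RingHom.id_apply, smul_eq_mul, ← integral_const_mul]
        refine integral_congr_ae ?_
        filter_upwards [Lp.coeFn_smul c f] with x hx
        rw [hx, Pi.smul_apply, smul_eq_mul, mul_assoc] }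
    K
    (fun f => by
      rw [L1.norm_eq_integral_norm]
      exact h.abs_integral_mul_le (L1.integrable_coeFn f))

theorem testL_apply {X : Type*} [MeasurableSpace X] {μ : Measure X} {ψ : X → ℝ} {K : ℝ}
    (h : IsTest ψ K) (f : Lp ℝ 1 μ) : testL h f = ∫ x, f x * ψ x ∂μ := rfl

theorem isTest_one {X : Type*} [MeasurableSpace X] : IsTest (fun _ : X => (1 : ℝ)) 1 :=
  ⟨measurable_const, fun _ => by simp⟩

/-- The total mass. -/
def mass : L1R →L[ℝ] ℝ := testL isTest_one

theorem mass_apply (f : L1R) : mass f = ∫ x, f x := by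
  rw [mass, testL_apply]
  simp only [mul_one]

theorem isProbDensity_iff {f : L1R} : IsProbDensity f ↔ 0 ≤ f ∧ mass f = 1 := by
  rw [IsProbDensity, mass_apply, ← Lp.coeFn_nonneg]
  rfl

theorem IsProbDensity.norm_eq {X : Type*} [MeasureSpace X] {f : Lp ℝ 1 (volume : Measure X)}
    (h : IsProbDensity f) : ‖f‖ = 1 := by
  rw [L1.norm_eq_integral_norm, ← h.2]
  refine integral_congr_ae ?_
  filter_upwards [h.1] with x hx
  exact Real.norm_of_nonneg hx

theorem isClosed_isProbDensity : IsClosed {f : L1R | IsProbDensity f} := by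
  simp only [isProbDensity_iff]
  exact (isClosed_Ici (a := (0 : L1R))).inter (isClosed_eq mass.continuous continuous_const)

theorem isProbDensity_combination {f h : L1R} (hf : IsProbDensity f) (hh : IsProbDensity h)
    {a b : ℝ} (ha : 0 ≤ a) (hb : 0 ≤ b) (hab : a + b = 1) : IsProbDensity (a • f + b • h) := by
  constructor
  · filter_upwards [hf.1, hh.1, Lp.coeFn_add (a • f) (b • h), Lp.coeFn_smul a f,
      Lp.coeFn_smul b h] with x h1 h2 h3 h4 h5
    rw [h3, Pi.add_apply, h4, h5]
    simp only [Pi.smul_apply, smul_eq_mul]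
    positivity
  · have h1 := (isProbDensity_iff.mp hf).2
    have h2 := (isProbDensity_iff.mp hh).2
    rw [← mass_apply, map_add, map_smul, map_smul, h1, h2, smul_eq_mul, smul_eq_mul, mul_one,
      mul_one, hab]

theorem isProbDensity_gainOp {f h : L1R} (hf : IsProbDensity f) (hh : IsProbDensity h) :
    IsProbDensity (gainOp f h) := by
  have hfi := L1.integrable_coeFn f
  have hhi := L1.integrable_coeFn h
  constructor
  -- Nonnegativity holds only almost everywhere, while the gain term evaluates at rotated points.
  -- Absolute values give representatives that are nonnegative everywhere.
  · have e1 : (f : ℝ → ℝ) =ᵐ[volume] fun x => |f x| := by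
      filter_upwards [hf.1] with x hx using (abs_of_nonneg hx).symm
    have e2 : (h : ℝ → ℝ) =ᵐ[volume] fun x => |h x| := by
      filter_upwards [hh.1] with x hx using (abs_of_nonneg hx).symm
    filter_upwards [coeFn_gainOp f h, gain_congr hfi hfi.abs hhi hhi.abs e1 e2] with x h1 h2
    rw [h1, h2, gain_eq_pairGain]
    exact pairGain_nonneg (fun p => mul_nonneg (abs_nonneg _) (abs_nonneg _)) x
  · rw [integral_congr_ae (coeFn_gainOp f h), integral_gain hfi hhi, hf.2, hh.2, mul_one]

theorem isProbDensity_gaussL1 {β : ℝ} (hβ : 0 < β) : IsProbDensity (gaussL1 β) := by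
  constructor
  · filter_upwards [coeFn_gaussL1 β] with x hx
    rw [hx]
    exact gauss_nonneg β x
  · rw [integral_congr_ae (coeFn_gaussL1 β), integral_gauss hβ]

/-! ### The vector field: local Lipschitz bounds, invariance of densities, solutions -/

section Field

open scoped NNReal
open Metric

variable {E F : Type*} [NormedAddCommGroup E] [NormedSpace ℝ E] [NormedAddCommGroup F]
  [NormedSpace ℝ F]

theorem exists_lipschitzOnWith_bilinear {G H : Type*} [NormedAddCommGroup G] [NormedSpace ℝ G]
    [NormedAddCommGroup H] [NormedSpace ℝ H] (B : G →L[ℝ] H →L[ℝ] F) (P : E →L[ℝ] G)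
    (Q : E →L[ℝ] H) (R : ℝ) :
    ∃ L : ℝ≥0, LipschitzOnWith L (fun x => B (P x) (Q x)) (closedBall 0 R) := by
  set R' := max R 0
  have hR' : 0 ≤ R' := le_max_right _ _
  refine ⟨⟨2 * ‖B‖ * ‖P‖ * ‖Q‖ * R', by positivity⟩,
    LipschitzOnWith.of_dist_le_mul fun x hx y hy => ?_⟩
  have hx' : ‖x‖ ≤ R' := (mem_closedBall_zero_iff.mp hx).trans (le_max_left _ _)
  have hy' : ‖y‖ ≤ R' := (mem_closedBall_zero_iff.mp hy).trans (le_max_left _ _)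
  have e : B (P x) (Q x) - B (P y) (Q y) = B (P (x - y)) (Q x) + B (P y) (Q (x - y)) := by
    simp only [map_sub, sub_apply]
    abel
  rw [dist_eq_norm, dist_eq_norm, e]
  refine (norm_add_le _ _).trans ?_
  change _ ≤ 2 * ‖B‖ * ‖P‖ * ‖Q‖ * R' * ‖x - y‖
  have h1 : ‖B (P (x - y)) (Q x)‖ ≤ ‖B‖ * (‖P‖ * ‖x - y‖) * (‖Q‖ * R') := by
    refine (B.le_opNorm₂ _ _).trans ?_
    gcongr
    · exact P.le_opNorm _
    · exact (Q.le_opNorm _).trans (by gcongr)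
  have h2 : ‖B (P y) (Q (x - y))‖ ≤ ‖B‖ * (‖P‖ * R') * (‖Q‖ * ‖x - y‖) := by
    refine (B.le_opNorm₂ _ _).trans ?_
    gcongr
    · exact (P.le_opNorm _).trans (by gcongr)
    · exact Q.le_opNorm _
  calc _ ≤ _ := add_le_add h1 h2
    _ = _ := by ring

/-- The right hand side of the first equation of the Boltzmann–Kac system. -/
def thermostatedField (α lam η β : ℝ) (x : L1R × L1R) : L1R :=
  (2 * lam) • (gainOp x.1 (α • x.1 + (1 - α) • x.2) - x.1) + η • (mass x.1 • gaussL1 β - x.1)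

/-- The right hand side of the second equation of the Boltzmann–Kac system. -/
def freeField (α lam : ℝ) (x : L1R × L1R) : L1R :=
  (2 * lam) • (gainOp x.2 (α • x.1 + (1 - α) • x.2) - x.2)

/-- The vector field of the Boltzmann–Kac system. -/
def kacField (α lam η β : ℝ) (x : L1R × L1R) : L1R × L1R :=
  (thermostatedField α lam η β x, freeField α lam x)

theorem exists_lipschitzOnWith_kacField (α lam η β R : ℝ) :
    ∃ L : ℝ≥0, LipschitzOnWith L (kacField α lam η β) (closedBall 0 R) := by
  let p := ContinuousLinearMap.fst ℝ L1R L1R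
  let q := ContinuousLinearMap.snd ℝ L1R L1R
  let m := α • p + (1 - α) • q
  let A := (-(2 * lam)) • p + η • ((mass.comp p).smulRight (gaussL1 β) - p)
  let A' := (-(2 * lam)) • q
  obtain ⟨L₁, h1⟩ := exists_lipschitzOnWith_bilinear gainOp ((2 * lam) • p) m R
  obtain ⟨L₂, h2⟩ := exists_lipschitzOnWith_bilinear gainOp ((2 * lam) • q) m R
  have h3 := (h1.add (A.lipschitz.lipschitzOnWith (s := closedBall 0 R))).prodMk
    (h2.add (A'.lipschitz.lipschitzOnWith (s := closedBall 0 R)))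
  suffices h : kacField α lam η β = fun x => (gainOp (((2 * lam) • p) x) (m x) + A x,
      gainOp (((2 * lam) • q) x) (m x) + A' x) from h ▸ ⟨_, h3⟩
  funext x
  simp only [kacField, thermostatedField, freeField, p, q, m, A, A',
    add_apply, smul_apply, sub_apply,
    ContinuousLinearMap.smulRight_apply, ContinuousLinearMap.comp_apply,
    ContinuousLinearMap.coe_fst', ContinuousLinearMap.coe_snd', map_smul]
  refine Prod.ext ?_ ?_
  · simp only [smul_sub, neg_smul]; abel
  · simp only [smul_sub, neg_smul]; abel

theorem coeFn_mixture (α : ℝ) (a b : L1R) :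
    (α • a + (1 - α) • b : L1R) =ᵐ[volume] fun w => α * a w + (1 - α) * b w := by
  filter_upwards [Lp.coeFn_add (α • a) ((1 - α) • b), Lp.coeFn_smul α a,
    Lp.coeFn_smul (1 - α) b] with w h1 h2 h3
  rw [h1, Pi.add_apply, h2, h3]
  rfl

theorem coeFn_gainOp_mixture (α : ℝ) (f a b : L1R) :
    gainOp f (α • a + (1 - α) • b) =ᵐ[volume] gain f (fun w => α * a w + (1 - α) * b w) := by
  have hf := L1.integrable_coeFn f
  have hm := L1.integrable_coeFn (α • a + (1 - α) • b)
  exact (coeFn_gainOp _ _).trans (gain_congr hf hf hm (hm.congr (coeFn_mixture α a b))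
    (EventuallyEq.refl _ _) (coeFn_mixture α a b))

theorem coeFn_thermostatedField (α lam η β : ℝ) (a b : L1R) :
    thermostatedField α lam η β (a, b) =ᵐ[volume] fun v =>
      2 * lam * (gain a (fun w => α * a w + (1 - α) * b w) v - a v)
        + η * (gauss β v * (∫ w, a w) - a v) := by
  simp only [thermostatedField]
  filter_upwards [coeFn_gainOp_mixture α a a b, coeFn_gaussL1 β,
    Lp.coeFn_add ((2 * lam) • (gainOp a (α • a + (1 - α) • b) - a))
      (η • (mass a • gaussL1 β - a)),
    Lp.coeFn_smul (2 * lam) (gainOp a (α • a + (1 - α) • b) - a),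
    Lp.coeFn_sub (gainOp a (α • a + (1 - α) • b)) a,
    Lp.coeFn_smul η (mass a • gaussL1 β - a), Lp.coeFn_sub (mass a • gaussL1 β) a,
    Lp.coeFn_smul (mass a) (gaussL1 β)] with v h1 h2 h3 h4 h5 h6 h7 h8
  rw [h3, Pi.add_apply, h4, Pi.smul_apply, h5, Pi.sub_apply, h1, h6, Pi.smul_apply, h7,
    Pi.sub_apply, h8, Pi.smul_apply, h2, mass_apply]
  simp only [smul_eq_mul]
  ring

theorem coeFn_freeField (α lam : ℝ) (a b : L1R) :
    freeField α lam (a, b) =ᵐ[volume] fun v =>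
      2 * lam * (gain b (fun w => α * a w + (1 - α) * b w) v - b v) := by
  simp only [freeField]
  filter_upwards [coeFn_gainOp_mixture α b a b,
    Lp.coeFn_smul (2 * lam) (gainOp b (α • a + (1 - α) • b) - b),
    Lp.coeFn_sub (gainOp b (α • a + (1 - α) • b)) b] with v h1 h4 h5
  rw [h4, Pi.smul_apply, h5, Pi.sub_apply, h1]
  rfl

theorem isBoltzmannKacSolution_iff {α lam η β : ℝ} {a₀ b₀ : L1R} {a b : ℝ → L1R} :
    IsBoltzmannKacSolution α lam η β a₀ b₀ a b ↔ a 0 = a₀ ∧ b 0 = b₀ ∧ ∀ t, 0 ≤ t →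
      HasDerivWithinAt a (thermostatedField α lam η β (a t, b t)) (Ici 0) t ∧
      HasDerivWithinAt b (freeField α lam (a t, b t)) (Ici 0) t := by
  constructor
  · intro h
    refine ⟨h.init_a, h.init_b, fun t ht => ⟨?_, ?_⟩⟩
    · obtain ⟨a', h1, h2⟩ := h.deriv_a t ht
      rwa [Lp.ext (h2.trans (coeFn_thermostatedField α lam η β _ _).symm)] at h1
    · obtain ⟨a', h1, h2⟩ := h.deriv_b t ht
      rwa [Lp.ext (h2.trans (coeFn_freeField α lam _ _).symm)] at h1
  · rintro ⟨h1, h2, h3⟩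
    exact ⟨h1, h2, fun t ht => ⟨_, (h3 t ht).1, coeFn_thermostatedField _ _ _ _ _ _⟩,
      fun t ht => ⟨_, (h3 t ht).2, coeFn_freeField _ _ _ _⟩⟩

/-- Pairs of probability densities. -/
def densityPairs : Set (L1R × L1R) := {f | IsProbDensity f} ×ˢ {f | IsProbDensity f}

theorem convex_densityPairs : Convex ℝ densityPairs := by
  have h : Convex ℝ {f : L1R | IsProbDensity f} := fun f hf g hg a b ha hb hab =>
    isProbDensity_combination hf hg ha hb hab
  exact h.prod h

theorem isClosed_densityPairs : IsClosed densityPairs :=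
  isClosed_isProbDensity.prod isClosed_isProbDensity

theorem norm_le_of_mem_densityPairs {x : L1R × L1R} (hx : x ∈ densityPairs) : ‖x‖ ≤ 1 :=
  max_le hx.1.norm_eq.le hx.2.norm_eq.le

/-- An Euler step of length `1 / (2 lam + η)` cancels the loss terms of the first equation. It
leaves convex combinations of a gain term with the Gaussian in the first component and with the old
density in the second. -/
theorem add_smul_kacField_mem {α lam η β : ℝ} (hα0 : 0 ≤ α) (hα1 : α ≤ 1) (hlam : 0 < lam)
    (hη : 0 < η) (hβ : 0 < β) {x : L1R × L1R} (hx : x ∈ densityPairs) :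
    x + (2 * lam + η)⁻¹ • kacField α lam η β x ∈ densityPairs := by
  obtain ⟨f, h⟩ := x
  obtain ⟨hf, hh⟩ : IsProbDensity f ∧ IsProbDensity h := hx
  have hm := isProbDensity_combination hf hh hα0 (sub_nonneg.mpr hα1) (add_sub_cancel _ _)
  have hc : 0 < 2 * lam + η := by positivity
  have hs : 2 * lam / (2 * lam + η) + η / (2 * lam + η) = 1 := by
    rw [← add_div, div_self hc.ne']
  have h1 := isProbDensity_combination (isProbDensity_gainOp hf hm) (isProbDensity_gaussL1 hβ)
    (by positivity) (by positivity) hs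
  have h2 := isProbDensity_combination (isProbDensity_gainOp hh hm) hh
    (by positivity) (by positivity) hs
  refine ⟨?_, ?_⟩
  · change IsProbDensity _
    convert h1 using 1
    have : mass f = 1 := (isProbDensity_iff.mp hf).2
    simp only [kacField, thermostatedField, Prod.mk_add_mk, Prod.smul_mk, this, one_smul]
    match_scalars <;> field_simp
    ring
  · change IsProbDensity _
    convert h2 using 1
    simp only [kacField, freeField, Prod.mk_add_mk, Prod.smul_mk]
    match_scalars <;> field_simp
    ring

theorem exists_isBoltzmannKacSolution {α lam η β : ℝ} (hα0 : 0 ≤ α) (hα1 : α ≤ 1) (hlam : 0 < lam)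
    (hη : 0 < η) (hβ : 0 < β) {a₀ b₀ : L1R} (ha : IsProbDensity a₀) (hb : IsProbDensity b₀) :
    ∃ a b : ℝ → L1R, IsBoltzmannKacSolution α lam η β a₀ b₀ a b := by
  obtain ⟨x, hx0, hx⟩ := exists_hasDerivWithinAt_Ici_of_mem
    (exists_lipschitzOnWith_kacField α lam η β) convex_densityPairs isClosed_densityPairs
    (fun x => norm_le_of_mem_densityPairs) (by positivity : 0 < 2 * lam + η)
    (fun x => add_smul_kacField_mem hα0 hα1 hlam hη hβ) (x₀ := (a₀, b₀)) ⟨ha, hb⟩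
  refine ⟨fun t => (x t).1, fun t => (x t).2, isBoltzmannKacSolution_iff.mpr
    ⟨by rw [hx0], by rw [hx0], fun t ht => ⟨?_, ?_⟩⟩⟩
  · exact (ContinuousLinearMap.fst ℝ L1R L1R).hasFDerivAt.comp_hasDerivWithinAt t (hx t ht)
  · exact (ContinuousLinearMap.snd ℝ L1R L1R).hasFDerivAt.comp_hasDerivWithinAt t (hx t ht)

/-- The invariance principle applies to every solution, so this does not rely on the one constructed
for existence. -/
theorem IsBoltzmannKacSolution.isProbDensity {α lam η β : ℝ} (hα0 : 0 ≤ α) (hα1 : α ≤ 1)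
    (hlam : 0 < lam) (hη : 0 < η) (hβ : 0 < β) {a₀ b₀ : L1R} (ha : IsProbDensity a₀)
    (hb : IsProbDensity b₀) {a b : ℝ → L1R} (h : IsBoltzmannKacSolution α lam η β a₀ b₀ a b)
    {t : ℝ} (ht : 0 ≤ t) : IsProbDensity (a t) ∧ IsProbDensity (b t) := by
  obtain ⟨h1, h2, h3⟩ := isBoltzmannKacSolution_iff.mp h
  exact mem_of_hasDerivWithinAt_Ici (x := fun t => (a t, b t))
    (exists_lipschitzOnWith_kacField α lam η β) convex_densityPairs isClosed_densityPairs
    (fun x => norm_le_of_mem_densityPairs) (by positivity : 0 < 2 * lam + η)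
    (fun x => add_smul_kacField_mem hα0 hα1 hlam hη hβ)
    (fun t ht => (h3 t ht).1.prodMk (h3 t ht).2) (by rw [h1, h2]; exact ⟨ha, hb⟩) ht

end Field

/-! ### The generator tested against functions of few particles -/

section Generator

variable {n l : ℕ}

theorem norm_avgOp_apply_le {T X : Type*} [MeasurableSpace T] [MeasurableSpace X] {τ : Measure T}
    {μ : Measure X} [SFinite τ] [SFinite μ] {k : T × X → ℝ} {Φ : T × X → X} {C : ℝ}
    (h : IsAveraging τ μ k Φ C) (f : Lp ℝ 1 μ) : ‖avgOp h f‖ ≤ C * ‖f‖ := by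
  rw [L1.norm_eq_integral_norm, L1.norm_eq_integral_norm]
  refine le_trans (le_of_eq (integral_congr_ae ?_)) (h.norm_avg (L1.integrable_coeFn f))
  filter_upwards [Integrable.coeFn_toL1 (h.integrable_avg (L1.integrable_coeFn f))] with x hx
  exact congrArg norm hx

theorem norm_collisionOp_apply_le {i j : Fin n} (hij : i ≠ j) (f : L1 n) :
    ‖collisionOp i j hij f‖ ≤ ‖f‖ := by
  have h := norm_avgOp_apply_le (isAveraging_rotate hij) f
  rw [one_mul] at h
  exact h

theorem norm_thermostatOp_apply_le {β : ℝ} (hβ : 0 < β) (i : Fin n) (f : L1 n) :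
    ‖thermostatOp β i f‖ ≤ ‖f‖ := by
  have h := norm_avgOp_apply_le (isAveraging_thermostat β i) f
  simp_rw [Real.norm_of_nonneg (gauss_nonneg β _), integral_gauss hβ, one_mul] at h
  exact h

/-- Sums over pairs `p < q` are half the sums over pairs `p ≠ q`. -/
theorem sum_lt_eq_half (D : Fin n → Fin n → ℝ) (hD : ∀ p q, D p q = D q p) (h0 : ∀ p, D p p = 0) :
    ∑ x : {x : Fin n × Fin n // x.1 < x.2}, D x.1.1 x.1.2 = (∑ p, ∑ q, D p q) / 2 := by
  have h1 : ∑ x : {x : Fin n × Fin n // x.1 < x.2}, D x.1.1 x.1.2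
      = ∑ x : Fin n × Fin n, if x.1 < x.2 then D x.1 x.2 else 0 := by
    rw [← Finset.sum_filter]
    exact (Finset.sum_subtype _ (fun x => by simp) fun x : Fin n × Fin n => D x.1 x.2).symm
  have h2 : ∑ p, ∑ q, D p q = ∑ x : Fin n × Fin n, ((if x.1 < x.2 then D x.1 x.2 else 0)
      + if x.2 < x.1 then D x.2 x.1 else 0) := by
    rw [← Fintype.sum_prod_type']
    refine Finset.sum_congr rfl fun x _ => ?_
    rcases lt_trichotomy x.1 x.2 with h | h | h
    · simp [h, h.not_gt]
    · simp [h, h0]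
    · simp [h, h.not_gt, hD x.1 x.2]
  have h3 : ∑ x : Fin n × Fin n, (if x.2 < x.1 then D x.2 x.1 else 0)
      = ∑ x : Fin n × Fin n, if x.1 < x.2 then D x.1 x.2 else 0 :=
    (Equiv.prodComm (Fin n) (Fin n)).sum_comp
      fun x : Fin n × Fin n => if x.1 < x.2 then D x.1 x.2 else 0
  rw [h1, h2, Finset.sum_add_distrib, h3]
  ring

theorem card_lt_pairs (n : ℕ) :
    (Fintype.card {x : Fin n × Fin n // x.1 < x.2} : ℝ) = n * (n - 1) / 2 := by
  have h := sum_lt_eq_half (n := n) (fun p q => if p = q then 0 else 1)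
    (fun p q => by simp only [eq_comm]) (by simp)
  have h1 : ∀ x : {x : Fin n × Fin n // x.1 < x.2}, (if x.1.1 = x.1.2 then (0 : ℝ) else 1) = 1 :=
    fun x => if_neg x.2.ne
  have h2 : ∀ p q : Fin n, (if p = q then (0 : ℝ) else 1) = 1 - if p = q then 1 else 0 := by
    intro p q; split_ifs <;> simp
  simp only [h1] at h
  simp only [h2, Finset.sum_sub_distrib, Finset.sum_ite_eq, Finset.mem_univ, if_true] at h
  simp at h
  rw [h]
  ring

theorem choose_two_eq (n : ℕ) : (n.choose 2 : ℝ) = n * (n - 1) / 2 := Nat.cast_choose_two ℝ n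

theorem norm_meanCollisionOp_apply_le (f : L1 n) : ‖meanCollisionOp n f‖ ≤ ‖f‖ := by
  rw [meanCollisionOp, smul_apply, norm_smul, sum_apply, norm_inv,
    RCLike.norm_natCast]
  refine (mul_le_mul_of_nonneg_left (norm_sum_le_of_le _ fun p _ =>
    norm_collisionOp_apply_le p.2.ne f) (by positivity)).trans ?_
  rw [Finset.sum_const, nsmul_eq_mul, ← mul_assoc, Finset.card_univ, card_lt_pairs,
    ← choose_two_eq]
  exact mul_le_of_le_one_left (norm_nonneg _) (inv_mul_le_one_of_le₀ le_rfl (Nat.cast_nonneg _))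

/-- The positions of the thermostated particles. -/
abbrev thermostatedPositions (m₀ n₀ n : ℕ) : Finset (Fin n) :=
  Finset.univ.filter fun i => i.val ∈ thermostated m₀ n₀

/-- The generator is `c` times a contraction minus the identity, with `c` the total jump rate. Hence
the closed unit ball is stable under Euler steps of length `1 / c`, and so under the flow. -/
theorem norm_evolution_apply_le {m₀ n₀ : ℕ} (hn : 0 < n) {lam η β : ℝ} (hlam : 0 < lam)
    (hη : 0 < η) (hβ : 0 < β) {f : L1 n} (hf : ‖f‖ ≤ 1) {t : ℝ} (ht : 0 ≤ t) :
    ‖evolution m₀ n₀ n lam η β t f‖ ≤ 1 := by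
  set G := generator m₀ n₀ n lam η β with hG
  set c : ℝ := n * lam + η * (thermostatedPositions m₀ n₀ n).card with hc
  have hc0 : 0 < c := by positivity
  have hderiv : ∀ s : ℝ, HasDerivAt (fun s => evolution m₀ n₀ n lam η β s f)
      (G (evolution m₀ n₀ n lam η β s f)) s := fun s =>
    (ContinuousLinearMap.apply ℝ (L1 n) f).hasFDerivAt.comp_hasDerivAt s
      (hasDerivAt_exp_smul_const' G s)
  have hmem : ∀ x ∈ Metric.closedBall (0 : L1 n) 1,
      x + c⁻¹ • G x ∈ Metric.closedBall (0 : L1 n) 1 := by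
    intro x hx
    rw [mem_closedBall_zero_iff] at hx ⊢
    have e : x + c⁻¹ • G x = c⁻¹ • ((n * lam) • meanCollisionOp n x +
        η • ∑ i ∈ thermostatedPositions m₀ n₀ n, thermostatOp β i x) := by
      have e1 : G x = ((n * lam) • meanCollisionOp n x +
        η • ∑ i ∈ thermostatedPositions m₀ n₀ n, thermostatOp β i x) - c • x := by
        simp only [hG, generator, add_apply, smul_apply, sub_apply, sum_apply,
          ContinuousLinearMap.id_apply, Finset.sum_sub_distrib, Finset.sum_const, hc]
        rw [add_smul, mul_smul η, Nat.cast_smul_eq_nsmul, smul_sub, smul_sub]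
        abel
      rw [e1, smul_sub, smul_smul, inv_mul_cancel₀ hc0.ne', one_smul]
      abel
    rw [e, norm_smul, norm_inv, Real.norm_of_nonneg hc0.le, inv_mul_le_one₀ hc0]
    refine (norm_add_le _ _).trans ?_
    rw [norm_smul, norm_smul, Real.norm_of_nonneg hη.le,
      Real.norm_of_nonneg (by positivity : 0 ≤ n * lam)]
    have h2 : ‖∑ i ∈ thermostatedPositions m₀ n₀ n, thermostatOp β i x‖
        ≤ (thermostatedPositions m₀ n₀ n).card := by
      refine (norm_sum_le_of_le (f := fun i => thermostatOp β i x) _ fun i _ =>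
        (norm_thermostatOp_apply_le hβ i x).trans hx).trans ?_
      simp
    calc _ ≤ n * lam * 1 + η * (thermostatedPositions m₀ n₀ n).card := by
          gcongr
          exact (norm_meanCollisionOp_apply_le x).trans hx
      _ = c := by rw [mul_one]
  have h := mem_of_hasDerivWithinAt (v := G) G.lipschitz (convex_closedBall (0 : L1 n) 1)
    Metric.isClosed_closedBall hc0 hmem (x := fun s => evolution m₀ n₀ n lam η β s f) (T := t)
    (fun s _ => (hderiv s).continuousAt.continuousWithinAt) (fun s _ => (hderiv s).hasDerivWithinAt)
    (by simpa [evolution] using hf) t ⟨ht, le_rfl⟩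
  simpa using h

/-! ### Adjoint operators on functions of few particles -/

theorem comp_rotate {e : Fin l → Fin n} (he : Function.Injective e) {i j : Fin l} (hij : i ≠ j)
    (θ : ℝ) (v : Fin n → ℝ) : rotate (e i) (e j) θ v ∘ e = rotate i j θ (v ∘ e) := by
  funext k
  simp only [Function.comp_apply, rotate_apply hij, rotate_apply (he.ne hij), he.eq_iff]

theorem collisionDual_of_notMem (ψ : (Fin l → ℝ) → ℝ) {e : Fin l → Fin n} {p q : Fin n}
    (hpq : p ≠ q) (hp : p ∉ range e) (hq : q ∉ range e) (v : Fin n → ℝ) :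
    collisionDual p q (fun v => ψ (v ∘ e)) v = ψ (v ∘ e) := by
  have h : ∀ θ, rotate p q θ v ∘ e = v ∘ e := by
    intro θ
    funext k
    have h1 : e k ≠ p := fun h => hp ⟨k, h⟩
    have h2 : e k ≠ q := fun h => hq ⟨k, h⟩
    simp only [Function.comp_apply, rotate_apply hpq, h1, h2, if_false]
  simp only [collisionDual, h, integral_const, smul_eq_mul, probReal_univ, one_mul]

theorem injective_vecCons {e : Fin l → Fin n} (he : Function.Injective e) {q : Fin n}
    (hq : q ∉ range e) : Function.Injective (Matrix.vecCons q e : Fin (l + 1) → Fin n) :=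
  Fin.cons_injective_iff.mpr ⟨hq, he⟩

theorem collisionDual_of_mem (φ : (Fin l → ℝ) → ℝ) {e : Fin l → Fin n}
    (he : Function.Injective e) (i : Fin l) {q : Fin n} (hq : q ∉ range e) (v : Fin n → ℝ) :
    collisionDual (e i) q (fun v => φ (v ∘ e)) v = collideNew i φ (v ∘ Matrix.vecCons q e) := by
  have he' := injective_vecCons he hq
  simp only [collideNew, collisionDual]
  congr 1
  funext θ
  have h := comp_rotate he' (Fin.succ_ne_zero i) (-θ) v
  simp only [Matrix.cons_val_succ, Matrix.cons_val_zero] at h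
  rw [← h]
  rfl

theorem thermostatDual_of_notMem {β : ℝ} (hβ : 0 < β) (φ : (Fin l → ℝ) → ℝ) {e : Fin l → Fin n}
    {p : Fin n} (hp : p ∉ range e) (v : Fin n → ℝ) :
    thermostatDual β p (fun v => φ (v ∘ e)) v = φ (v ∘ e) := by
  have h : ∀ w, Function.update v p w ∘ e = v ∘ e := fun w => by
    funext k
    have h1 : e k ≠ p := fun h => hp ⟨k, h⟩
    simp [h1]
  simp only [thermostatDual, h, integral_mul_const, integral_gauss hβ, one_mul]

theorem thermostatDual_of_mem (β : ℝ) (φ : (Fin l → ℝ) → ℝ) {e : Fin l → Fin n}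
    (he : Function.Injective e) (i : Fin l) (v : Fin n → ℝ) :
    thermostatDual β (e i) (fun v => φ (v ∘ e)) v = thermostatDual β i φ (v ∘ e) := by
  simp only [thermostatDual, Function.update_comp_eq_of_injective _ he]

/-- The integral of `F` against a function `φ` of the particles with positions `e`. -/
def obs (F : L1 n) (φ : (Fin l → ℝ) → ℝ) (e : Fin l → Fin n) : ℝ := ∫ v, F v * φ (v ∘ e)

theorem IsTest.comp_positions {φ : (Fin l → ℝ) → ℝ} {K : ℝ} (hφ : IsTest φ K)
    (e : Fin l → Fin n) : IsTest (fun v : Fin n → ℝ => φ (v ∘ e)) K :=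
  hφ.comp (measurable_pi_lambda _ fun i => measurable_pi_apply (e i))

theorem abs_obs_le {φ : (Fin l → ℝ) → ℝ} {K : ℝ} (hφ : IsTest φ K) (F : L1 n)
    (e : Fin l → Fin n) : |obs F φ e| ≤ K * ‖F‖ := by
  rw [L1.norm_eq_integral_norm]
  exact (hφ.comp_positions e).abs_integral_mul_le (L1.integrable_coeFn F)

theorem hasDerivAt_obs_evolution (m₀ n₀ : ℕ) (lam η β : ℝ) (f : L1 n) {φ : (Fin l → ℝ) → ℝ}
    {K : ℝ} (hφ : IsTest φ K) (e : Fin l → Fin n) (t : ℝ) :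
    HasDerivAt (fun s => obs (evolution m₀ n₀ n lam η β s f) φ e)
      (obs (generator m₀ n₀ n lam η β (evolution m₀ n₀ n lam η β t f)) φ e) t := by
  have h1 : HasDerivAt (fun s => evolution m₀ n₀ n lam η β s f)
      (generator m₀ n₀ n lam η β (evolution m₀ n₀ n lam η β t f)) t :=
    (ContinuousLinearMap.apply ℝ (L1 n) f).hasFDerivAt.comp_hasDerivAt t
      (hasDerivAt_exp_smul_const' _ t)
  exact (testL (μ := volume) (hφ.comp_positions e)).hasFDerivAt.comp_hasDerivAt t h1

/-- The effect of the collision of `p` and `q` on the integral of `F` against `ψ`. -/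
def collisionDefect (F : L1 n) (ψ : (Fin n → ℝ) → ℝ) (p q : Fin n) : ℝ :=
  if p = q then 0 else (∫ v, F v * collisionDual p q ψ v) - ∫ v, F v * ψ v

theorem abs_collisionDefect_le {ψ : (Fin n → ℝ) → ℝ} {K : ℝ} (hψ : IsTest ψ K) (F : L1 n)
    (p q : Fin n) : |collisionDefect F ψ p q| ≤ 2 * (K * ‖F‖) := by
  have hK := hψ.nonneg
  rw [collisionDefect]
  split_ifs with h
  · rw [abs_zero]; positivity
  · have h1 := (hψ.collisionDual h).abs_integral_mul_le (L1.integrable_coeFn F)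
    have h2 := hψ.abs_integral_mul_le (L1.integrable_coeFn F)
    rw [← L1.norm_eq_integral_norm] at h1 h2
    rw [← Real.norm_eq_abs]
    refine (norm_sub_le _ _).trans ?_
    rw [Real.norm_eq_abs, Real.norm_eq_abs]
    linarith

theorem collisionDefect_symm (F : L1 n) (ψ : (Fin n → ℝ) → ℝ) (p q : Fin n) :
    collisionDefect F ψ p q = collisionDefect F ψ q p := by
  rcases eq_or_ne p q with rfl | h
  · rfl
  · rw [collisionDefect, collisionDefect, if_neg h, if_neg h.symm, collisionDual_symm h]

/-- The factor 1/2 relating ordered to unordered pairs cancels the one in `n.choose 2`. -/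
theorem integral_meanCollisionOp_sub {ψ : (Fin n → ℝ) → ℝ} {K : ℝ} (hψ : IsTest ψ K) (F : L1 n)
    (hn : 2 ≤ n) :
    ∫ v, (meanCollisionOp n - ContinuousLinearMap.id ℝ (L1 n)) F v * ψ v
      = (n * (n - 1) : ℝ)⁻¹ * ∑ p, ∑ q, collisionDefect F ψ p q := by
  have hn' : (2 : ℝ) ≤ n := by exact_mod_cast hn
  have hn0 : (n : ℝ) ≠ 0 := by linarith
  have hn1 : (n : ℝ) - 1 ≠ 0 := by linarith
  rw [← testL_apply hψ, sub_apply, ContinuousLinearMap.id_apply, map_sub, meanCollisionOp,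
    smul_apply, sum_apply, map_smul, map_sum]
  simp only [testL_apply, integral_collisionOp _ _ hψ]
  have h1 : ∀ x : {x : Fin n × Fin n // x.1 < x.2},
      ∫ v, F v * collisionDual x.1.1 x.1.2 ψ v
        = collisionDefect F ψ x.1.1 x.1.2 + ∫ v, F v * ψ v := fun x => by
    rw [collisionDefect, if_neg x.2.ne, sub_add_cancel]
  simp only [h1]
  rw [Finset.sum_add_distrib, sum_lt_eq_half _ (collisionDefect_symm F ψ)
    (fun p => if_pos rfl), Finset.sum_const, Finset.card_univ, nsmul_eq_mul, card_lt_pairs,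
    choose_two_eq, smul_eq_mul]
  field_simp
  ring

/-- Pairs outside `range e` have no effect. Pairs with exactly one observed member occur in both
orders, whence the factor 2. The at most `l ^ 2` pairs inside are kept apart as the error. -/
theorem sum_collisionDefect {φ : (Fin l → ℝ) → ℝ} (F : L1 n) {e : Fin l → Fin n}
    (he : Function.Injective e) :
    ∑ p, ∑ q, collisionDefect F (fun v => φ (v ∘ e)) p q =
      2 * ∑ i, ∑ q with q ∉ range e, (obs F (collideNew i φ) (Matrix.vecCons q e) - obs F φ e)
      + ∑ i, ∑ j, collisionDefect F (fun v => φ (v ∘ e)) (e i) (e j) := by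
  classical
  set D := collisionDefect F (fun v => φ (v ∘ e)) with hD
  have hsplit : ∀ h : Fin n → ℝ, ∑ p, h p = ∑ i, h (e i) + ∑ q with q ∉ range e, h q := by
    intro h
    rw [← Finset.sum_filter_add_sum_filter_not Finset.univ (· ∈ range e) h]
    congr 1
    rw [← Finset.sum_image (f := h) (g := e) (s := Finset.univ) he.injOn]
    refine Finset.sum_congr ?_ fun _ _ => rfl
    ext p; simp
  have h1 : ∀ p q, p ∉ range e → q ∉ range e → D p q = 0 := by
    intro p q hp hq
    rw [hD, collisionDefect]
    split_ifs with h
    · rfl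
    · simp only [collisionDual_of_notMem φ h hp hq, sub_self]
  have h2 : ∀ i, ∀ q, q ∉ range e →
      D (e i) q = obs F (collideNew i φ) (Matrix.vecCons q e) - obs F φ e := by
    intro i q hq
    rw [hD, collisionDefect, if_neg fun h => hq ⟨i, h⟩]
    simp only [collisionDual_of_mem φ he i hq]
    rfl
  have h3 : ∑ i, ∑ q with q ∉ range e, D (e i) q
      = ∑ i, ∑ q with q ∉ range e,
        (obs F (collideNew i φ) (Matrix.vecCons q e) - obs F φ e) :=
    Finset.sum_congr rfl fun i _ => Finset.sum_congr rfl fun q hq =>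
      h2 i q (Finset.mem_filter.mp hq).2
  have h4 : ∑ p with p ∉ range e, ∑ q, D p q = ∑ i, ∑ q with q ∉ range e, D (e i) q := by
    rw [Finset.sum_comm (s := Finset.univ) (t := Finset.univ.filter (· ∉ range e))
      (f := fun i q => D (e i) q)]
    refine Finset.sum_congr rfl fun p hp => ?_
    rw [hsplit, Finset.sum_eq_zero (s := Finset.univ.filter (· ∉ range e)) fun q hq =>
      h1 p q (Finset.mem_filter.mp hp).2 (Finset.mem_filter.mp hq).2, add_zero]
    exact Finset.sum_congr rfl fun i _ => collisionDefect_symm F _ _ _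
  rw [hsplit, h4, ← h3]
  simp only [hsplit (fun q => D (e _) q), Finset.sum_add_distrib]
  ring

theorem sum_thermostat_defect {m₀ n₀ : ℕ} {β : ℝ} (hβ : 0 < β) {φ : (Fin l → ℝ) → ℝ} (F : L1 n)
    {e : Fin l → Fin n} (he : Function.Injective e) :
    ∑ p : Fin n with p.val ∈ thermostated m₀ n₀,
      ((∫ v, F v * thermostatDual β p (fun v => φ (v ∘ e)) v) - obs F φ e)
    = ∑ i with (e i).val ∈ thermostated m₀ n₀,
      (obs F (thermostatDual β i φ) e - obs F φ e) := by
  classical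
  have h1 : ∀ p, p ∉ range e →
      (∫ v, F v * thermostatDual β p (fun v => φ (v ∘ e)) v) - obs F φ e = 0 := by
    intro p hp
    simp only [thermostatDual_of_notMem hβ φ hp]
    exact sub_self _
  have h2 : ∀ i, (∫ v, F v * thermostatDual β (e i) (fun v => φ (v ∘ e)) v)
      = obs F (thermostatDual β i φ) e := by
    intro i
    simp only [thermostatDual_of_mem β φ he]
    rfl
  simp only [← h2]
  rw [← Finset.sum_image (g := e)
    (f := fun p => (∫ v, F v * thermostatDual β p (fun v => φ (v ∘ e)) v) - obs F φ e) he.injOn]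
  refine (Finset.sum_subset ?_ ?_).symm
  · intro p hp
    simp only [Finset.mem_image, Finset.mem_filter, Finset.mem_univ, true_and] at hp ⊢
    obtain ⟨i, hi, rfl⟩ := hp
    exact hi
  · intro p hp hp'
    refine h1 p fun ⟨i, hi⟩ => hp' ?_
    simp only [Finset.mem_image, Finset.mem_filter, Finset.mem_univ, true_and] at hp ⊢
    exact ⟨i, hi ▸ hp, hi⟩

/-- The action of the generator on functions of `l` particles, up to an error of order `1 / n`. -/
theorem abs_obs_generator_sub_le {m₀ n₀ : ℕ} {lam η β : ℝ} (hlam : 0 < lam) (hβ : 0 < β)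
    {φ : (Fin l → ℝ) → ℝ} {K : ℝ} (hφ : IsTest φ K) {F : L1 n} (hF : ‖F‖ ≤ 1)
    {e : Fin l → Fin n} (he : Function.Injective e) (hn : 2 ≤ n) :
    |obs (generator m₀ n₀ n lam η β F) φ e
      - (2 * lam / (n - 1) * ∑ i, ∑ q with q ∉ range e,
          (obs F (collideNew i φ) (Matrix.vecCons q e) - obs F φ e)
        + η * ∑ i with (e i).val ∈ thermostated m₀ n₀,
          (obs F (thermostatDual β i φ) e - obs F φ e))| ≤ 2 * lam * K * l ^ 2 / (n - 1) := by
  have hn' : (2 : ℝ) ≤ n := by exact_mod_cast hn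
  have hn1 : (0 : ℝ) < n - 1 := by linarith
  have hψ := hφ.comp_positions e
  have hK := hφ.nonneg
  have e1 : obs (generator m₀ n₀ n lam η β F) φ e
      = n * lam * ((n * (n - 1) : ℝ)⁻¹ * ∑ p, ∑ q, collisionDefect F (fun v => φ (v ∘ e)) p q)
        + η * ∑ i with (e i).val ∈ thermostated m₀ n₀,
          (obs F (thermostatDual β i φ) e - obs F φ e) := by
    rw [← sum_thermostat_defect hβ F he, ← integral_meanCollisionOp_sub hψ F hn]
    rw [obs, ← testL_apply hψ, ← testL_apply hψ, generator, add_apply, map_add, smul_apply,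
      map_smul, smul_apply, map_smul, sum_apply, map_sum, smul_eq_mul,
      smul_eq_mul]
    congr 2
    refine Finset.sum_congr rfl fun p _ => ?_
    rw [sub_apply, map_sub, testL_apply, testL_apply, integral_thermostatOp _ _ _ hψ]
    rfl
  -- Recollisions among the observed particles: `l ^ 2` terms of size at most `2 * K`, without a sum
  -- over partners to offset the prefactor `lam / (n - 1)`.
  have e2 : |∑ i, ∑ j, collisionDefect F (fun v => φ (v ∘ e)) (e i) (e j)| ≤ l ^ 2 * (2 * K) := by
    have h : ∀ i j, |collisionDefect F (fun v => φ (v ∘ e)) (e i) (e j)| ≤ 2 * K := fun i j =>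
      (abs_collisionDefect_le hψ F _ _).trans (by nlinarith)
    refine (Finset.abs_sum_le_sum_abs _ _).trans ((Finset.sum_le_sum fun i _ =>
      (Finset.abs_sum_le_sum_abs _ _).trans (Finset.sum_le_sum fun j _ => h i j)).trans ?_)
    simp only [Finset.sum_const, Finset.card_univ, Fintype.card_fin, nsmul_eq_mul]
    exact le_of_eq (by ring)
  rw [e1, sum_collisionDefect F he]
  set S := ∑ i, ∑ q with q ∉ range e, (obs F (collideNew i φ) (Matrix.vecCons q e) - obs F φ e)
  set R := ∑ i, ∑ j, collisionDefect F (fun v => φ (v ∘ e)) (e i) (e j)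
  set P := ∑ i with (e i).val ∈ thermostated m₀ n₀, (obs F (thermostatDual β i φ) e - obs F φ e)
  have e3 : n * lam * ((n * (n - 1) : ℝ)⁻¹ * (2 * S + R)) + η * P
      - (2 * lam / (n - 1) * S + η * P) = lam / (n - 1) * R := by
    field_simp
    ring
  rw [e3, abs_mul, abs_of_pos (by positivity)]
  calc lam / (n - 1) * |R| ≤ lam / (n - 1) * (l ^ 2 * (2 * K)) := by gcongr
    _ = _ := by ring

end Generator

/-! ### The mean field limit -/

/-- Whether the particle with position `i` is thermostated. -/
def label (m₀ n₀ i : ℕ) : Bool := decide (i ∈ thermostated m₀ n₀)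

theorem label_eq_true {m₀ n₀ i : ℕ} : label m₀ n₀ i = true ↔ i ∈ thermostated m₀ n₀ :=
  decide_eq_true_iff

/-- The marginal density of a species. -/
def species (a b : L1R) (s : Bool) : L1R := if s then a else b

/-- The integral of `φ` against the product of the densities of the species `c`. -/
def meanField {l : ℕ} (a b : L1R) (c : Fin l → Bool) (φ : (Fin l → ℝ) → ℝ) : ℝ :=
  tens (fun i => species a b (c i)) φ

section MeanField

variable {l : ℕ} {φ : (Fin l → ℝ) → ℝ} {K : ℝ}

theorem isProbDensity_species {a b : L1R} (ha : IsProbDensity a) (hb : IsProbDensity b)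
    (s : Bool) : IsProbDensity (species a b s) := by
  cases s
  · exact hb
  · exact ha

theorem abs_meanField_le (hφ : IsTest φ K) {a b : L1R} (ha : IsProbDensity a)
    (hb : IsProbDensity b) (c : Fin l → Bool) : |meanField a b c φ| ≤ K := by
  refine (abs_tens_le hφ fun i => L1.integrable_coeFn _).trans (le_of_eq ?_)
  have h : ∀ i, ∫ x, ‖species a b (c i) x‖ = 1 := fun i => by
    rw [← L1.norm_eq_integral_norm, (isProbDensity_species ha hb _).norm_eq]
  simp only [h, Finset.prod_const_one, mul_one]

theorem tensL_apply (hφ : IsTest φ K) (g : Fin l → L1R) : tensL hφ g = tens (fun i => g i) φ := rfl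

theorem tensL_update_gainOp (hφ : IsTest φ K) (g : Fin l → L1R) (i : Fin l) (m : L1R) :
    tensL hφ (Function.update g i (gainOp (g i) m))
      = tensL (hφ.collideNew i) (Matrix.vecCons m g) := by
  rw [tensL_apply, tens_coeFn_update_congr _ _ _ (coeFn_gainOp _ _),
    ← tens_collideNew hφ (fun j => L1.integrable_coeFn (g j)) (L1.integrable_coeFn m), tensL_apply]
  congr 1
  funext j
  refine Fin.cases ?_ (fun j => ?_) j <;> simp

theorem tensL_update_gaussL1 (hφ : IsTest φ K) {β : ℝ} (hβ : 0 < β) (g : Fin l → L1R)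
    (i : Fin l) :
    tensL hφ (Function.update g i (mass (g i) • gaussL1 β))
      = tensL (hφ.thermostatDual hβ i) g := by
  have h : (mass (g i) • gaussL1 β : L1R) =ᵐ[volume] fun x => gauss β x * ∫ w, g i w := by
    filter_upwards [Lp.coeFn_smul (mass (g i)) (gaussL1 β), coeFn_gaussL1 β] with x h1 h2
    rw [h1, Pi.smul_apply, h2, mass_apply, smul_eq_mul, mul_comm]
  rw [tensL_apply, tens_coeFn_update_congr _ _ _ h, tensL_apply,
    ← tens_thermostatDual hφ (fun j => L1.integrable_coeFn (g j))]

/-- Multilinearity splits a partner drawn from the mixture into a partner of either species, with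
weights `α` and `1 - α`. -/
theorem tensL_vecCons_mixture {φ : (Fin (l + 1) → ℝ) → ℝ} (hφ : IsTest φ K) (g : Fin l → L1R)
    (α : ℝ) (a b : L1R) :
    tensL hφ (Matrix.vecCons (α • a + (1 - α) • b) g)
      = α * tensL hφ (Matrix.vecCons a g) + (1 - α) * tensL hφ (Matrix.vecCons b g) := by
  have h1 := (tensL hφ).cons_add g (α • a) ((1 - α) • b)
  rw [(tensL hφ).cons_smul, (tensL hφ).cons_smul] at h1
  exact h1

/-- The mean field limit satisfies the limiting hierarchy. -/
theorem hasDerivWithinAt_meanField (hφ : IsTest φ K) {α lam η β : ℝ} (hβ : 0 < β)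
    {a₀ b₀ : L1R} {a b : ℝ → L1R} (h : IsBoltzmannKacSolution α lam η β a₀ b₀ a b)
    (c : Fin l → Bool) {t : ℝ} (ht : 0 ≤ t) :
    HasDerivWithinAt (fun t => meanField (a t) (b t) c φ)
      (2 * lam * ∑ i, (α * meanField (a t) (b t) (Matrix.vecCons true c) (collideNew i φ)
          + (1 - α) * meanField (a t) (b t) (Matrix.vecCons false c) (collideNew i φ)
          - meanField (a t) (b t) c φ)
        + η * ∑ i with c i = true, (meanField (a t) (b t) c (thermostatDual β i φ)
          - meanField (a t) (b t) c φ)) (Ici 0) t := by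
  have hd := (isBoltzmannKacSolution_iff.mp h).2.2 t ht
  set g : Fin l → L1R := fun i => species (a t) (b t) (c i) with hg
  have hs : ∀ i, HasDerivWithinAt (fun t => species (a t) (b t) (c i))
      ((2 * lam) • (gainOp (g i) (α • a t + (1 - α) • b t) - g i) +
        if c i = true then η • (mass (g i) • gaussL1 β - g i) else 0) (Ici 0) t := by
    intro i
    rcases hc : c i with _ | _
    · simpa [hg, hc, species, freeField] using hd.2
    · simpa [hg, hc, species, thermostatedField] using hd.1
  refine (hasDerivWithinAt_tens hφ hs).congr_deriv ?_
  have hcons : ∀ s, (fun j => species (a t) (b t) (Matrix.vecCons s c j))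
      = Matrix.vecCons (species (a t) (b t) s) g := by
    intro s
    funext j
    refine Fin.cases ?_ (fun j => ?_) j <;> simp [hg]
  have hm : ∀ s i, meanField (a t) (b t) (Matrix.vecCons s c) (collideNew i φ)
      = tensL (hφ.collideNew i) (Matrix.vecCons (species (a t) (b t) s) g) := by
    intro s i
    rw [← hcons]
    rfl
  have hself : ∀ i, tensL hφ (Function.update g i (g i)) = meanField (a t) (b t) c φ := by
    intro i
    rw [Function.update_eq_self]
    rfl
  -- The contribution of slot `i`: gain minus loss, plus the thermostat term if the particle in this
  -- slot is thermostated.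
  have key : ∀ i, tens (fun j => Function.update g i
      ((2 * lam) • (gainOp (g i) (α • a t + (1 - α) • b t) - g i) +
        if c i = true then η • (mass (g i) • gaussL1 β - g i) else 0) j) φ
      = 2 * lam * (α * meanField (a t) (b t) (Matrix.vecCons true c) (collideNew i φ)
          + (1 - α) * meanField (a t) (b t) (Matrix.vecCons false c) (collideNew i φ)
          - meanField (a t) (b t) c φ)
        + if c i = true then η * (meanField (a t) (b t) c (thermostatDual β i φ)
          - meanField (a t) (b t) c φ) else 0 := by
    intro i
    have e1 : tensL hφ (Function.update g i
        ((2 * lam) • (gainOp (g i) (α • a t + (1 - α) • b t) - g i)))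
        = 2 * lam * (α * meanField (a t) (b t) (Matrix.vecCons true c) (collideNew i φ)
          + (1 - α) * meanField (a t) (b t) (Matrix.vecCons false c) (collideNew i φ)
          - meanField (a t) (b t) c φ) := by
      rw [(tensL hφ).map_update_smul, (tensL hφ).map_update_sub, tensL_update_gainOp,
        tensL_vecCons_mixture, hself, hm, hm]
      rfl
    rw [← tensL_apply hφ, (tensL hφ).map_update_add, e1]
    congr 1
    split_ifs with hc
    · rw [(tensL hφ).map_update_smul, (tensL hφ).map_update_sub, tensL_update_gaussL1 hφ hβ, hself]
      rfl
    · exact (tensL hφ).map_update_zero _ _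
  refine (Finset.sum_congr rfl fun i _ => key i).trans ?_
  simp only [Finset.sum_add_distrib, ← Finset.mul_sum, Finset.sum_filter, ← mul_ite_zero]

end MeanField

/-! ### Convergence of the hierarchy -/

theorem label_add_mul (m₀ n₀ k i : ℕ) : label m₀ n₀ (k * n₀ + i) = label m₀ n₀ i := by
  have h : (k * n₀ + i + 1) % n₀ = (i + 1) % n₀ := by
    rw [add_assoc, mul_comm, Nat.mul_add_mod]
  refine decide_eq_decide.mpr ?_
  simp only [thermostated, mem_ofPred_eq, h]

theorem label_of_lt {m₀ n₀ i : ℕ} (hmn : m₀ < n₀) (hi : i < n₀) :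
    label m₀ n₀ i = decide (i < m₀) := by
  have h : (i + 1) % n₀ ∈ Finset.Icc 1 m₀ ↔ i < m₀ := by
    rw [Finset.mem_Icc]
    rcases Nat.lt_or_ge (i + 1) n₀ with h | h
    · rw [Nat.mod_eq_of_lt h]; omega
    -- The last position of a block has a label of residue 0, hence is not thermostated; this agrees
    -- with `i < m₀` being false, as `m₀ < n₀`.
    · have : i + 1 = n₀ := by omega
      rw [this, Nat.mod_self]; omega
  simp only [label, thermostated, mem_ofPred_eq, h]

/-- Labels are periodic, and each of the `k` blocks has exactly `m₀` thermostated positions. So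
species averages over all particles have weights exactly `α` and `1 - α`. -/
theorem sum_label {m₀ n₀ : ℕ} (hmn : m₀ < n₀) (k : ℕ) (h : Bool → ℝ) :
    ∑ q : Fin (k * n₀), h (label m₀ n₀ q) = k * (m₀ * h true + (n₀ - m₀) * h false) := by
  rw [Fin.sum_univ_eq_sum_range fun q => h (label m₀ n₀ q)]
  have h1 : ∑ x ∈ Finset.range n₀, h (label m₀ n₀ x) = m₀ * h true + (n₀ - m₀) * h false := by
    have e : n₀ = m₀ + (n₀ - m₀) := by omega
    rw [e, Finset.sum_range_add, ← e]
    congr 1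
    · rw [Finset.sum_congr rfl (g := fun _ => h true) fun x hx => ?_]
      · simp
      · have := Finset.mem_range.mp hx
        rw [label_of_lt hmn (by omega), decide_eq_true this]
    · rw [Finset.sum_congr rfl (g := fun _ => h false) fun x hx => ?_]
      · simp [Nat.cast_sub hmn.le]
      · have := Finset.mem_range.mp hx
        rw [label_of_lt hmn (by omega), decide_eq_false (by omega)]
  induction k with
  | zero => simp
  | succ k ih =>
    rw [Nat.succ_mul, Finset.sum_range_add, ih]
    simp only [label_add_mul, h1]
    push_cast
    ring

/-- `e` lists distinct particles of the species `c`. -/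
structure IsListing (m₀ n₀ : ℕ) {n l : ℕ} (c : Fin l → Bool) (e : Fin l → Fin n) : Prop where
  injective : Function.Injective e
  label_eq : ∀ i, label m₀ n₀ (e i) = c i

theorem IsListing.vecCons {m₀ n₀ n l : ℕ} {c : Fin l → Bool} {e : Fin l → Fin n}
    (h : IsListing m₀ n₀ c e) {q : Fin n} (hq : q ∉ range e) :
    IsListing m₀ n₀ (Matrix.vecCons (label m₀ n₀ q) c) (Matrix.vecCons q e) :=
  ⟨injective_vecCons h.injective hq, Fin.cases rfl h.label_eq⟩

/-- If all the differences between particle system and mean field limit are at most `d`, then so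
is, up to constants and a small error, the difference of the generators. -/
theorem abs_generator_sub_meanField_le {m₀ n₀ k n l : ℕ} (hmn : m₀ < n₀) (hnk : n = k * n₀)
    (hn : 2 ≤ n) {lam η β : ℝ}
    (hlam : 0 < lam) (hη : 0 < η) (hβ : 0 < β) {φ : (Fin l → ℝ) → ℝ} {K : ℝ}
    (hφ : IsTest φ K) {F : L1 n} (hF : ‖F‖ ≤ 1) {a b : L1R} (ha : IsProbDensity a)
    (hb : IsProbDensity b) {c : Fin l → Bool} {e : Fin l → Fin n}
    (he : IsListing m₀ n₀ c e) {d : ℝ} (h0 : |obs F φ e - meanField a b c φ| ≤ d)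
    (h1 : ∀ i s (e' : Fin (l + 1) → Fin n), IsListing m₀ n₀ (Matrix.vecCons s c) e' →
      |obs F (collideNew i φ) e' - meanField a b (Matrix.vecCons s c) (collideNew i φ)| ≤ d)
    (h2 : ∀ i, |obs F (thermostatDual β i φ) e - meanField a b c (thermostatDual β i φ)| ≤ d) :
    |obs (generator m₀ n₀ n lam η β F) φ e -
      (2 * lam * ∑ i, ((m₀ / n₀ : ℝ) * meanField a b (Matrix.vecCons true c) (collideNew i φ)
          + (1 - (m₀ / n₀ : ℝ)) * meanField a b (Matrix.vecCons false c) (collideNew i φ)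
          - meanField a b c φ)
        + η * ∑ i with c i = true, (meanField a b c (thermostatDual β i φ)
          - meanField a b c φ))|
      ≤ l * (8 * lam + 2 * η) * d + 8 * lam * K * (l + 1) ^ 2 / ((n : ℝ) - 1) := by
  classical
  have hd : 0 ≤ d := (abs_nonneg _).trans h0
  have hK := hφ.nonneg
  have hn' : (2 : ℝ) ≤ n := by exact_mod_cast hn
  have hn1 : (0 : ℝ) < n - 1 := by linarith
  have hn₀ : (0 : ℝ) < n₀ := by exact_mod_cast (by omega : 0 < n₀)
  have hgen := abs_obs_generator_sub_le (m₀ := m₀) (n₀ := n₀) (η := η) hlam hβ hφ hF he.injective hn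
  have hlab : ∀ i, (e i).val ∈ thermostated m₀ n₀ ↔ c i = true := fun i => by
    rw [← he.label_eq, label_eq_true]
  simp only [hlab] at hgen
  -- `X i s` is the mean field effect of a collision of particle `i` with one of species `s`; `Y i`
  -- below averages it over the species of the partner.
  set X : Fin l → Bool → ℝ := fun i s =>
    meanField a b (Matrix.vecCons s c) (collideNew i φ) - meanField a b c φ with hX
  have hXb : ∀ i s, |X i s| ≤ 2 * K := fun i s => by
    have e1 := abs_meanField_le (hφ.collideNew i) ha hb (Matrix.vecCons s c)
    have e2 := abs_meanField_le hφ ha hb c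
    rw [← Real.norm_eq_abs] at e1 e2 ⊢
    exact (norm_sub_le _ _).trans (by linarith)
  set Y : Fin l → ℝ := fun i => (m₀ / n₀ : ℝ) * X i true + (1 - (m₀ / n₀ : ℝ)) * X i false with hY
  have hα0 : 0 ≤ (m₀ / n₀ : ℝ) := by positivity
  have hα1 : (m₀ / n₀ : ℝ) ≤ 1 := (div_le_one hn₀).mpr (by exact_mod_cast hmn.le)
  have hYb : ∀ i, |Y i| ≤ 2 * K := fun i => by
    refine (abs_add_le _ _).trans ?_
    rw [abs_mul, abs_mul, abs_of_nonneg hα0, abs_of_nonneg (sub_nonneg.mpr hα1)]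
    calc _ ≤ (m₀ / n₀ : ℝ) * (2 * K) + (1 - (m₀ / n₀ : ℝ)) * (2 * K) := by
          gcongr
          · exact hXb i true
          · exact hXb i false
      _ = 2 * K := by ring
  have hcol : ∀ i, |∑ q with q ∉ range e,
      (obs F (collideNew i φ) (Matrix.vecCons q e) - obs F φ e) - (n - 1) * Y i|
        ≤ n * (2 * d) + 2 * K * (l + 1) := by
    intro i
    have s1 : ∑ q : Fin n, X i (label m₀ n₀ q) = n * Y i := by
      subst hnk
      rw [sum_label hmn, hY]
      push_cast
      field_simp
    have s2 : ∑ q : Fin n, X i (label m₀ n₀ q)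
        = ∑ j, X i (c j) + ∑ q with q ∉ range e, X i (label m₀ n₀ q) := by
      rw [← Finset.sum_filter_add_sum_filter_not Finset.univ (· ∈ range e)]
      congr 1
      have : Finset.univ.filter (· ∈ range e) = Finset.univ.image e := by ext p; simp
      rw [this, Finset.sum_image he.injective.injOn]
      exact Finset.sum_congr rfl fun j _ => by rw [he.label_eq]
    -- The first sum compares each partner with its mean field value, at a cost of `2 * d`. The
    -- second bracket corrects for the `l` excluded partners and for `n - 1` in place of `n`.
    have s3 : ∑ q with q ∉ range e, (obs F (collideNew i φ) (Matrix.vecCons q e) - obs F φ e)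
        - (n - 1) * Y i
        = ∑ q with q ∉ range e, (obs F (collideNew i φ) (Matrix.vecCons q e) - obs F φ e
            - X i (label m₀ n₀ q)) + (Y i - ∑ j, X i (c j)) := by
      rw [Finset.sum_sub_distrib (f := fun q =>
        obs F (collideNew i φ) (Matrix.vecCons q e) - obs F φ e)]
      linear_combination s1 - s2
    rw [s3]
    refine (abs_add_le _ _).trans (add_le_add ?_ ?_)
    · refine (Finset.abs_sum_le_sum_abs _ _).trans
        ((Finset.sum_le_card_nsmul _ _ (2 * d) fun q hq => ?_).trans ?_)
      · have hq' := (Finset.mem_filter.mp hq).2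
        have e1 := h1 i _ _ (he.vecCons hq')
        have e2 : obs F (collideNew i φ) (Matrix.vecCons q e) - obs F φ e - X i (label m₀ n₀ q)
          = (obs F (collideNew i φ) (Matrix.vecCons q e)
            - meanField a b (Matrix.vecCons (label m₀ n₀ q) c) (collideNew i φ))
            - (obs F φ e - meanField a b c φ) := by rw [hX]; ring
        rw [← Real.norm_eq_abs] at e1 h0 ⊢
        rw [e2]
        exact (norm_sub_le _ _).trans (by linarith)
      · rw [nsmul_eq_mul]
        gcongr
        exact_mod_cast (Finset.card_le_univ _).trans_eq (Fintype.card_fin n)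
    · have e1 : |∑ j, X i (c j)| ≤ l * (2 * K) := by
        refine (Finset.abs_sum_le_sum_abs _ _).trans
          ((Finset.sum_le_card_nsmul _ _ (2 * K) fun j _ => hXb i _).trans ?_)
        simp
      have e2 := hYb i
      rw [← Real.norm_eq_abs] at e1 e2 ⊢
      exact (norm_sub_le _ _).trans (by linarith)
  set S : Fin l → ℝ := fun i => ∑ q with q ∉ range e,
    (obs F (collideNew i φ) (Matrix.vecCons q e) - obs F φ e) with hS
  have hcolsum : |2 * lam / (n - 1) * ∑ i, S i - 2 * lam * ∑ i, Y i|
      ≤ 2 * lam / (n - 1) * (l * (n * (2 * d) + 2 * K * (l + 1))) := by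
    have e1 : 2 * lam / (n - 1) * ∑ i, S i - 2 * lam * ∑ i, Y i
        = 2 * lam / (n - 1) * ∑ i, (S i - (n - 1) * Y i) := by
      rw [Finset.sum_sub_distrib, ← Finset.mul_sum]
      field_simp
    rw [e1, abs_mul, abs_of_pos (by positivity)]
    gcongr
    refine (Finset.abs_sum_le_sum_abs _ _).trans
      ((Finset.sum_le_card_nsmul _ _ _ fun i _ => hcol i).trans ?_)
    rw [Finset.card_univ, Fintype.card_fin, nsmul_eq_mul]
  have htherm : |η * ∑ i with c i = true, (obs F (thermostatDual β i φ) e - obs F φ e)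
      - η * ∑ i with c i = true, (meanField a b c (thermostatDual β i φ) - meanField a b c φ)|
      ≤ η * (l * (2 * d)) := by
    rw [← mul_sub, ← Finset.sum_sub_distrib, abs_mul, abs_of_pos hη]
    gcongr
    refine (Finset.abs_sum_le_sum_abs _ _).trans
      ((Finset.sum_le_card_nsmul _ _ (2 * d) fun i _ => ?_).trans ?_)
    · have e1 := h2 i
      have e2 : obs F (thermostatDual β i φ) e - obs F φ e
          - (meanField a b c (thermostatDual β i φ) - meanField a b c φ)
        = (obs F (thermostatDual β i φ) e - meanField a b c (thermostatDual β i φ))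
          - (obs F φ e - meanField a b c φ) := by ring
      rw [← Real.norm_eq_abs] at e1 h0 ⊢
      rw [e2]
      exact (norm_sub_le _ _).trans (by linarith)
    · rw [nsmul_eq_mul]
      gcongr
      exact_mod_cast (Finset.card_le_univ _).trans_eq (Fintype.card_fin l)
  have hYeq : ∀ i, (m₀ / n₀ : ℝ) * meanField a b (Matrix.vecCons true c) (collideNew i φ)
          + (1 - (m₀ / n₀ : ℝ)) * meanField a b (Matrix.vecCons false c) (collideNew i φ)
          - meanField a b c φ = Y i := fun i => by rw [hY, hX]; ring
  simp only [hYeq]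
  -- The constant `8 * lam` multiplying `l * d` comes from `n / (n - 1) ≤ 2`, the one in the error
  -- from `2 l² + 4 l (l + 1) ≤ 8 (l + 1)²`.
  have hfin : 2 * lam * K * l ^ 2 / (n - 1)
      + (2 * lam / (n - 1) * (l * (n * (2 * d) + 2 * K * (l + 1))) + η * (l * (2 * d)))
      ≤ l * (8 * lam + 2 * η) * d + 8 * lam * K * (l + 1) ^ 2 / ((n : ℝ) - 1) := by
    have e1 : (n : ℝ) / (n - 1) ≤ 2 := by rw [div_le_iff₀ hn1]; linarith
    have e2 : 2 * lam * K * l ^ 2 / (n - 1)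
      + (2 * lam / (n - 1) * (l * (n * (2 * d) + 2 * K * (l + 1))) + η * (l * (2 * d)))
      = 4 * lam * l * d * (n / (n - 1)) + 2 * η * l * d
        + lam * K * (2 * l ^ 2 + 4 * l * (l + 1)) / (n - 1) := by
      field_simp
      ring
    have e3 : 4 * lam * l * d * ((n : ℝ) / (n - 1)) ≤ 4 * lam * l * d * 2 := by gcongr
    have e4 : lam * K * (2 * (l : ℝ) ^ 2 + 4 * l * (l + 1)) / (n - 1)
        ≤ 8 * lam * K * (l + 1) ^ 2 / (n - 1) := by
      rw [mul_assoc 8, mul_comm 8 (lam * K), mul_assoc (lam * K)]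
      gcongr
      nlinarith [(Nat.cast_nonneg l : (0 : ℝ) ≤ l)]
    rw [e2]
    linarith
  refine le_trans ?_ hfin
  have e5 := abs_add_le _ _ |>.trans (add_le_add hgen
    ((abs_add_le _ _).trans (add_le_add hcolsum htherm)))
  refine le_of_eq_of_le (congrArg _ ?_) e5
  ring

/-- Uniform version of chaos: the marginals of any `l` particles of the species `c` converge,
uniformly in the choice of the particles. -/
def IsUniformlyChaotic (m₀ n₀ : ℕ) (G : (k : ℕ) → L1 (k * n₀)) (a b : L1R) : Prop :=
  ∀ (l : ℕ) (c : Fin l → Bool) (φ : (Fin l → ℝ) → ℝ) (K : ℝ), IsTest φ K → ∀ ε : ℝ, 0 < ε →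
    ∀ᶠ k in atTop, ∀ e : Fin l → Fin (k * n₀), IsListing m₀ n₀ c e →
      |obs (G k) φ e - meanField a b c φ| ≤ ε

theorem ascFactorial_le_succ (l m : ℕ) : l.ascFactorial m ≤ (l + 1).ascFactorial m := by
  rw [Nat.ascFactorial_eq_prod_range, Nat.ascFactorial_eq_prod_range]
  exact Finset.prod_le_prod' fun i _ => by omega

theorem mul_succ_ascFactorial (l m : ℕ) : l * (l + 1).ascFactorial m = l.ascFactorial (m + 1) := by
  rw [Nat.ascFactorial_succ]
  exact Nat.succ_ascFactorial l m

/-- The quotient is a binomial coefficient. Its growth is only exponential in `m`, so a time step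
independent of `l` suffices. -/
theorem ascFactorial_div_factorial_le (l m : ℕ) :
    (l.ascFactorial m / m.factorial : ℝ) ≤ 2 ^ l * 2 ^ m := by
  rw [Nat.ascFactorial_eq_factorial_mul_choose', Nat.cast_mul,
    mul_div_cancel_left₀ _ (by positivity), ← pow_add]
  have h1 := Nat.choose_le_two_pow (l + m - 1) m
  have h2 : 2 ^ (l + m - 1) ≤ 2 ^ (l + m) := Nat.pow_le_pow_right two_pos (Nat.sub_le _ _)
  exact_mod_cast h1.trans h2

theorem tendsto_mul_atTop {n₀ : ℕ} (hn₀ : 0 < n₀) :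
    Tendsto (fun k : ℕ => k * n₀) atTop atTop :=
  tendsto_atTop_mono (fun k => Nat.le_mul_of_pos_right k hn₀) tendsto_id

/-! ### Propagation of uniform chaos in time -/

section Propagation

variable {m₀ n₀ : ℕ} {lam η β : ℝ} {f : (k : ℕ) → L1 (k * n₀)} {a₀ b₀ : L1R} {a b : ℝ → L1R}

/-- Iterated Duhamel estimate on a time interval of length one. -/
theorem eventually_abs_sub_meanField_le (hmn : m₀ < n₀) (hlam : 0 < lam) (hη : 0 < η) (hβ : 0 < β)
    (hf : ∀ k, 1 ≤ k → ‖f k‖ ≤ 1)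
    (hsol : IsBoltzmannKacSolution ((m₀ : ℝ) / (n₀ : ℝ)) lam η β a₀ b₀ a b)
    (ha : ∀ t, 0 ≤ t → IsProbDensity (a t)) (hb : ∀ t, 0 ≤ t → IsProbDensity (b t)) {t₀ : ℝ}
    (ht₀ : 0 ≤ t₀)
    (hchaos : IsUniformlyChaotic m₀ n₀
      (fun k => evolution m₀ n₀ (k * n₀) lam η β t₀ (f k)) (a t₀) (b t₀)) (m : ℕ) :
    ∀ (l : ℕ) (c : Fin l → Bool) (φ : (Fin l → ℝ) → ℝ) (K : ℝ), IsTest φ K → ∀ ε : ℝ, 0 < ε →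
      ∀ᶠ k in atTop, ∀ e : Fin l → Fin (k * n₀), IsListing m₀ n₀ c e →
        ∀ s ∈ Icc t₀ (t₀ + 1),
          |obs (evolution m₀ n₀ (k * n₀) lam η β s (f k)) φ e - meanField (a s) (b s) c φ|
            ≤ ε + 2 * K * ((8 * lam + 2 * η) ^ m * (s - t₀) ^ m *
              (l.ascFactorial m / m.factorial)) := by
  have hn₀ : 0 < n₀ := by omega
  have hnorm : ∀ k, 1 ≤ k → ∀ s, 0 ≤ s →
      ‖evolution m₀ n₀ (k * n₀) lam η β s (f k)‖ ≤ 1 := fun k hk s hs =>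
    norm_evolution_apply_le (Nat.mul_pos hk hn₀) hlam hη hβ (hf k hk) hs
  induction m with
  | zero =>
    -- Without iteration, both integrals are at most `K` in absolute value.
    intro l c φ K hφ ε hε
    filter_upwards [eventually_ge_atTop 1] with k hk e _ s hs
    have hs0 : 0 ≤ s := ht₀.trans hs.1
    have hK := hφ.nonneg
    have h1 := (abs_obs_le hφ _ e).trans (mul_le_of_le_one_right hK (hnorm k hk s hs0))
    have h2 := abs_meanField_le hφ (ha s hs0) (hb s hs0) c
    rw [← Real.norm_eq_abs] at h1 h2 ⊢
    refine (norm_sub_le _ _).trans ?_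
    simp only [pow_zero, Nat.ascFactorial_zero, Nat.factorial_zero, Nat.cast_one, div_one, mul_one]
    linarith
  | succ m ih =>
    intro l c φ K hφ ε hε
    have hK := hφ.nonneg
    set C : ℝ := 8 * lam + 2 * η with hC
    have hC0 : 0 < C := by positivity
    -- The generator estimate multiplies the error of the previous iterate by `l * C`. The three
    -- thirds of `ε` are for this, the initial error and the `1 / n` error.
    set ε' : ℝ := ε / (3 * (l * C + 1)) with hε'
    have hε'0 : 0 < ε' := by positivity
    have hlε : l * C * ε' ≤ ε / 3 := by
      have : ε / 3 = (l * C + 1) * ε' := by rw [hε']; field_simp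
      rw [this]
      nlinarith
    have hlim : Tendsto (fun k : ℕ => 8 * lam * K * (l + 1) ^ 2 / (((k * n₀ : ℕ) : ℝ) - 1)) atTop
        (𝓝 0) := by
      refine Tendsto.const_div_atTop (tendsto_atTop_add_const_right _ (-1 : ℝ) ?_) _
      exact tendsto_natCast_atTop_atTop.comp (tendsto_mul_atTop hn₀)
    have h3 : ∀ᶠ k in atTop, ∀ i s, ∀ e : Fin (l + 1) → Fin (k * n₀),
        IsListing m₀ n₀ (Matrix.vecCons s c) e → ∀ r ∈ Icc t₀ (t₀ + 1), _ :=
      eventually_all.mpr fun i => eventually_all.mpr fun s =>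
        ih (l + 1) (Matrix.vecCons s c) (collideNew i φ) K (hφ.collideNew i) ε' hε'0
    have h4 : ∀ᶠ k in atTop, ∀ i, ∀ e : Fin l → Fin (k * n₀),
        IsListing m₀ n₀ c e → ∀ r ∈ Icc t₀ (t₀ + 1), _ :=
      eventually_all.mpr fun i =>
        ih l c (thermostatDual β i φ) K (hφ.thermostatDual hβ i) ε' hε'0
    filter_upwards [eventually_ge_atTop 1, hchaos l c φ K hφ (ε / 3) (by positivity),
      ih l c φ K hφ ε' hε'0, h3, h4, hlim.eventually_le_const (by positivity : 0 < ε / 3),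
      (tendsto_mul_atTop hn₀).eventually_ge_atTop 2] with k hk hk1 hk2 hk3 hk4 hk5 hk6 e he
    -- The coefficient of level `l + 1` also dominates that of level `l`, so one bound `d` serves
    -- for all observables in the generator estimate.
    set M : ℝ := 2 * K * C ^ m * ((l + 1).ascFactorial m / m.factorial) with hM
    have hM0 : 0 ≤ M := by positivity
    have hd : ∀ r ∈ Icc t₀ (t₀ + 1), ε' + 2 * K * (C ^ m * (r - t₀) ^ m *
        (l.ascFactorial m / m.factorial)) ≤ ε' + M * (r - t₀) ^ m := by
      intro r hr
      have hr0 : 0 ≤ r - t₀ := sub_nonneg.mpr hr.1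
      have hle : (l.ascFactorial m : ℝ) ≤ (l + 1).ascFactorial m := by
        exact_mod_cast ascFactorial_le_succ l m
      calc _ ≤ ε' + 2 * K * (C ^ m * (r - t₀) ^ m * ((l + 1).ascFactorial m / m.factorial)) := by
            gcongr
        _ = _ := by rw [hM]; ring
    have hderiv : ∀ r ∈ Icc t₀ (t₀ + 1), HasDerivWithinAt
        (fun s => obs (evolution m₀ n₀ (k * n₀) lam η β s (f k)) φ e
          - meanField (a s) (b s) c φ) _ (Ici 0) r := fun r hr =>
      (hasDerivAt_obs_evolution m₀ n₀ lam η β (f k) hφ e r).hasDerivWithinAt.sub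
        (hasDerivWithinAt_meanField hφ hβ hsol c (ht₀.trans hr.1))
    -- Duhamel in differential form: `B` starts at the initial error, and its slope `B'` dominates
    -- the derivative of the difference.
    have key := image_norm_le_of_norm_deriv_right_le_deriv_boundary
      (f := fun s => obs (evolution m₀ n₀ (k * n₀) lam η β s (f k)) φ e
          - meanField (a s) (b s) c φ) (a := t₀) (b := t₀ + 1)
      (B := fun s => ε / 3 + 2 * ε / 3 * (s - t₀) + l * C * M / (m + 1) * (s - t₀) ^ (m + 1))
      (B' := fun s => 2 * ε / 3 + l * C * M * (s - t₀) ^ m)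
      (fun r hr => (hderiv r hr).continuousWithinAt.mono fun x hx => ht₀.trans hx.1)
      (fun r hr => (hderiv r ⟨hr.1, hr.2.le⟩).mono (Ici_subset_Ici.mpr (ht₀.trans hr.1)))
      ?_ ?_ ?_
    · intro s hs
      refine (key hs).trans ?_
      have hs1 : s - t₀ ≤ 1 := by linarith [hs.2]
      have hA : ((l.ascFactorial (m + 1) : ℕ) : ℝ) = l * (l + 1).ascFactorial m := by
        exact_mod_cast (mul_succ_ascFactorial l m).symm
      -- Integration supplies the factor `1 / (m + 1)`, and `l` times the ascending factorial from
      -- `l + 1` is the next ascending factorial from `l`.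
      have e1 : l * C * M / (m + 1) * (s - t₀) ^ (m + 1) = 2 * K * (C ^ (m + 1) *
          (s - t₀) ^ (m + 1) * (l.ascFactorial (m + 1) / (m + 1).factorial)) := by
        rw [hA, Nat.factorial_succ, hM]
        push_cast
        field_simp
        ring
      simp only [e1]
      nlinarith
    · simp only [sub_self, Real.norm_eq_abs]
      have := hk1 e he
      simpa using this
    · intro s
      have h1 : HasDerivAt (fun s : ℝ => s - t₀) 1 s := (hasDerivAt_id s).sub_const t₀
      have h2 := ((h1.const_mul (2 * ε / 3)).const_add (ε / 3)).add
        ((h1.pow (m + 1)).const_mul (l * C * M / (m + 1)))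
      refine h2.congr_deriv ?_
      push_cast
      field_simp
    · intro r hr
      have hr' : r ∈ Icc t₀ (t₀ + 1) := ⟨hr.1, hr.2.le⟩
      have hr0 : 0 ≤ r := ht₀.trans hr.1
      have hgen := abs_generator_sub_meanField_le (k := k) hmn rfl hk6 hlam hη hβ hφ
        (hnorm k hk r hr0) (ha r hr0) (hb r hr0) he
        (d := ε' + M * (r - t₀) ^ m)
        ((hk2 e he r hr').trans (hd r hr'))
        (fun i s e' he' => by
          have := hk3 i s e' he' r hr'
          refine this.trans (le_of_eq ?_)
          rw [hM]; ring)
        (fun i => (hk4 i e he r hr').trans (hd r hr'))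
      rw [Real.norm_eq_abs]
      refine hgen.trans ?_
      rw [← hC]
      linarith

theorem IsUniformlyChaotic.evolution_of_le (hmn : m₀ < n₀) (hlam : 0 < lam) (hη : 0 < η)
    (hβ : 0 < β) (hf : ∀ k, 1 ≤ k → ‖f k‖ ≤ 1)
    (hsol : IsBoltzmannKacSolution ((m₀ : ℝ) / (n₀ : ℝ)) lam η β a₀ b₀ a b)
    (ha : ∀ t, 0 ≤ t → IsProbDensity (a t)) (hb : ∀ t, 0 ≤ t → IsProbDensity (b t)) {t₀ : ℝ}
    (ht₀ : 0 ≤ t₀)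
    (hchaos : IsUniformlyChaotic m₀ n₀
      (fun k => evolution m₀ n₀ (k * n₀) lam η β t₀ (f k)) (a t₀) (b t₀)) {s : ℝ}
    (hs : s ∈ Icc t₀ (t₀ + min 1 (1 / (4 * (8 * lam + 2 * η))))) :
    IsUniformlyChaotic m₀ n₀
      (fun k => evolution m₀ n₀ (k * n₀) lam η β s (f k)) (a s) (b s) := by
  intro l c φ K hφ ε hε
  have hK := hφ.nonneg
  set C : ℝ := 8 * lam + 2 * η with hC
  have hC0 : 0 < C := by positivity
  have hs0 : 0 ≤ s - t₀ := sub_nonneg.mpr hs.1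
  have hs1 : s - t₀ ≤ 1 := by linarith [hs.2, min_le_left 1 (1 / (4 * C))]
  have hs2 : C * (s - t₀) ≤ 1 / 4 := by
    have h1 : s - t₀ ≤ 1 / (4 * C) := by linarith [hs.2, min_le_right 1 (1 / (4 * C))]
    calc C * (s - t₀) ≤ C * (1 / (4 * C)) := by gcongr
      _ = 1 / 4 := by field_simp
  have hlim : Tendsto (fun m : ℕ => 2 * K * 2 ^ l * (1 / 2 : ℝ) ^ m) atTop (𝓝 0) := by
    simpa using (tendsto_pow_atTop_nhds_zero_of_lt_one (by norm_num : (0 : ℝ) ≤ 1 / 2)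
      (by norm_num)).const_mul (2 * K * 2 ^ l)
  -- The number of iterations is fixed first, from `K`, `l` and `ε` alone; only then is `k` taken
  -- large.
  obtain ⟨m, hm⟩ := (hlim.eventually_le_const (by positivity : 0 < ε / 2)).exists
  filter_upwards [eventually_abs_sub_meanField_le hmn hlam hη hβ hf hsol ha hb ht₀ hchaos m l c φ K
    hφ (ε / 2) (by positivity)] with k hk e he
  refine (hk e he s ⟨hs.1, by linarith⟩).trans ?_
  have h1 : 2 * K * (C ^ m * (s - t₀) ^ m * (l.ascFactorial m / m.factorial))
      ≤ 2 * K * ((1 / 4) ^ m * (2 ^ l * 2 ^ m)) := by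
    rw [← mul_pow]
    gcongr
    exact ascFactorial_div_factorial_le l m
  have h2 : 2 * K * ((1 / 4 : ℝ) ^ m * (2 ^ l * 2 ^ m)) = 2 * K * 2 ^ l * (1 / 2 : ℝ) ^ m := by
    rw [show (1 / 2 : ℝ) = 1 / 4 * 2 by norm_num, mul_pow]
    ring
  rw [← hC]
  linarith

/-- Restarting at multiples of the step `τ` covers all times. The initial data stay `f k`, and the
contraction bound holds at every time, so no estimate deteriorates from one step to the next. -/
theorem IsUniformlyChaotic.evolution (hmn : m₀ < n₀) (hlam : 0 < lam) (hη : 0 < η)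
    (hβ : 0 < β) (hf : ∀ k, 1 ≤ k → ‖f k‖ ≤ 1)
    (hsol : IsBoltzmannKacSolution ((m₀ : ℝ) / (n₀ : ℝ)) lam η β a₀ b₀ a b)
    (ha : ∀ t, 0 ≤ t → IsProbDensity (a t)) (hb : ∀ t, 0 ≤ t → IsProbDensity (b t))
    (hchaos : IsUniformlyChaotic m₀ n₀ f a₀ b₀) {t : ℝ} (ht : 0 ≤ t) :
    IsUniformlyChaotic m₀ n₀
      (fun k => evolution m₀ n₀ (k * n₀) lam η β t (f k)) (a t) (b t) := by
  set τ : ℝ := min 1 (1 / (4 * (8 * lam + 2 * η))) with hτ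
  have hτ0 : 0 < τ := lt_min one_pos (by positivity)
  have h : ∀ j : ℕ, ∀ t ∈ Icc 0 (j * τ), IsUniformlyChaotic m₀ n₀
      (fun k => PartialKac.evolution m₀ n₀ (k * n₀) lam η β t (f k)) (a t) (b t) := by
    intro j
    induction j with
    | zero =>
      intro t ht
      have ht0 : t = 0 := by simpa using ht
      subst ht0
      simpa [PartialKac.evolution, hsol.init_a, hsol.init_b] using hchaos
    | succ j ih =>
      intro t ht
      rcases le_total t (j * τ) with h | h
      · exact ih t ⟨ht.1, h⟩
      · have hj : 0 ≤ j * τ := by positivity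
        refine (ih (j * τ) ⟨hj, le_rfl⟩).evolution_of_le hmn hlam hη hβ hf hsol ha hb hj ⟨h, ?_⟩
        have := ht.2
        push_cast at this
        linarith
  obtain ⟨j, hj⟩ := exists_nat_ge (t / τ)
  exact h j t ⟨ht, (div_le_iff₀ hτ0).mp hj⟩

end Propagation

/-! ### Chaos for symmetric sequences -/

/-- Variables that `φ` does not see integrate to 1 by Fubini. -/
theorem tens_comp_subtype {l n : ℕ} {p : Fin n → Prop} [DecidablePred p]
    (σ : Fin l ≃ {j // p j}) {g : Fin n → ℝ → ℝ} (hg : ∀ j, ∫ x, g j x = 1)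
    (φ : (Fin l → ℝ) → ℝ) :
    tens g (fun u => φ fun i => u (σ i)) = tens (fun i => g (σ i)) φ := by
  have hmp := volume_preserving_piEquivPiSubtypeProd (fun _ : Fin n => ℝ) p
  have h1 := hmp.integral_comp' fun q : ({j // p j} → ℝ) × ({j // ¬ p j} → ℝ) =>
    ((∏ i : {j // p j}, g i (q.1 i)) * φ (fun i => q.1 (σ i))) * ∏ j : {j // ¬ p j}, g j (q.2 j)
  have h2 : tens g (fun u => φ fun i => u (σ i)) = ∫ u : Fin n → ℝ,
      ((∏ i : {j // p j}, g i (u i)) * φ fun i => u (σ i)) * ∏ j : {j // ¬ p j}, g j (u j) := by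
    refine integral_congr_ae (Eventually.of_forall fun u => ?_)
    simp only [← Fintype.prod_subtype_mul_prod_subtype p fun j => g j (u j)]
    ring
  have h3 : ∫ x : {j // p j} → ℝ, (∏ i : {j // p j}, g i (x i)) * φ (fun i => x (σ i))
      = tens (fun i => g (σ i)) φ := by
    have hσ := volume_measurePreserving_piCongrLeft (fun _ : {j // p j} => ℝ) σ
    rw [← hσ.integral_comp', tens]
    refine integral_congr_ae (Eventually.of_forall fun u => ?_)
    have h4 : ∀ i, MeasurableEquiv.piCongrLeft (fun _ : {j // p j} => ℝ) σ u (σ i) = u i :=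
      fun i => Equiv.piCongrLeft_apply_apply (fun _ : {j // p j} => ℝ) σ u i
    simp only [← Equiv.prod_comp σ, h4]
  rw [h2]
  refine h1.trans ?_
  rw [Measure.volume_eq_prod, integral_prod_mul
    (fun x : {j // p j} → ℝ => (∏ i : {j // p j}, g i (x i)) * φ (fun i => x (σ i)))
    (fun y : {j // ¬ p j} → ℝ => ∏ j : {j // ¬ p j}, g j (y j)), h3,
    integral_fintype_prod_volume_eq_prod fun (j : {j // ¬ p j}) x => g j x]
  simp only [hg, Finset.prod_const_one, mul_one]

theorem tens_comp {l n : ℕ} {e : Fin l → Fin n} (he : Function.Injective e)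
    {g : Fin n → ℝ → ℝ} (hg : ∀ j, ∫ x, g j x = 1) (φ : (Fin l → ℝ) → ℝ) :
    tens g (fun u => φ (u ∘ e)) = tens (fun i => g (e i)) φ := by
  classical
  exact tens_comp_subtype (p := fun j => j ∈ range e) (Equiv.ofInjective e he) hg φ

theorem measurePreserving_comp_perm {n : ℕ} (σ : Equiv.Perm (Fin n)) :
    MeasurePreserving fun v : Fin n → ℝ => v ∘ σ := by
  have h := volume_measurePreserving_piCongrLeft (fun _ : Fin n => ℝ) σ.symm
  suffices e : (fun v : Fin n → ℝ => v ∘ σ)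
      = MeasurableEquiv.piCongrLeft (fun _ : Fin n => ℝ) σ.symm from e ▸ h
  funext v i
  have := Equiv.piCongrLeft_apply_apply (fun _ : Fin n => ℝ) σ.symm v (σ i)
  rw [Equiv.symm_apply_apply] at this
  exact this.symm

/-- The permutation is a product of transpositions, one per slot, each exchanging particles of the
same species. -/
theorem IsListing.exists_perm {m₀ n₀ n l : ℕ} {f : L1 n} (hf : IsPartiallySymmetric m₀ n₀ f)
    {c : Fin l → Bool} {e e' : Fin l → Fin n} (he : IsListing m₀ n₀ c e)
    (he' : IsListing m₀ n₀ c e') :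
    ∃ σ : Equiv.Perm (Fin n), (fun v : Fin n → ℝ => f (v ∘ σ)) =ᵐ[volume] f ∧
      ∀ i, σ (e i) = e' i := by
  -- That `σ` preserves labels is part of the induction: it makes the next transposition admissible
  -- for the symmetry of `f`.
  have h : ∀ j : ℕ, j ≤ l → ∃ σ : Equiv.Perm (Fin n),
      (∀ x, label m₀ n₀ (σ x) = label m₀ n₀ x) ∧
      (fun v : Fin n → ℝ => f (v ∘ σ)) =ᵐ[volume] f ∧ ∀ i : Fin l, i.val < j → σ (e i) = e' i := by
    intro j
    induction j with
    | zero =>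
      exact fun _ => ⟨1, fun _ => rfl, EventuallyEq.refl _ _, fun i hi => absurd hi (by simp)⟩
    | succ j ih =>
      intro hj
      obtain ⟨σ, h1, h2, h3⟩ := ih (by omega)
      let p : Fin l := ⟨j, hj⟩
      have hlab : label m₀ n₀ (σ (e p)) = label m₀ n₀ (e' p) := by
        rw [h1, he.label_eq, he'.label_eq]
      let τ := Equiv.swap (σ (e p)) (e' p)
      refine ⟨τ * σ, fun x => ?_, ?_, fun i hi => ?_⟩
      · rw [Equiv.Perm.mul_apply, ← h1 x]
        rcases eq_or_ne (σ x) (σ (e p)) with h | h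
        · rw [h, Equiv.swap_apply_left, hlab]
        · rcases eq_or_ne (σ x) (e' p) with h' | h'
          · rw [h', Equiv.swap_apply_right, hlab]
          · rw [Equiv.swap_apply_of_ne_of_ne h h']
      · have h4 := (measurePreserving_comp_perm τ).quasiMeasurePreserving.ae_eq_comp h2
        have h5 := hf (σ (e p)) (e' p) (by
          rw [← label_eq_true, ← label_eq_true, hlab])
        exact h4.trans h5
      · rw [Equiv.Perm.mul_apply]
        rcases Nat.lt_succ_iff_lt_or_eq.mp hi with h | h
        · rw [h3 i h]
          refine Equiv.swap_apply_of_ne_of_ne (fun h' => ?_) (fun h' => ?_)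
          · rw [← h3 i h] at h'
            have := he.injective (σ.injective h')
            rw [this] at h
            exact lt_irrefl _ h
          · rw [he'.injective h'] at h
            exact lt_irrefl _ h
        · have : i = p := Fin.ext h
          rw [this]
          exact Equiv.swap_apply_left _ _
  obtain ⟨σ, _, h2, h3⟩ := h l le_rfl
  exact ⟨σ, h2, fun i => h3 i i.isLt⟩

theorem IsPartiallySymmetric.obs_eq {m₀ n₀ n l : ℕ} {f : L1 n} (hf : IsPartiallySymmetric m₀ n₀ f)
    {φ : (Fin l → ℝ) → ℝ} {K : ℝ} (hφ : IsTest φ K) {c : Fin l → Bool} {e e' : Fin l → Fin n}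
    (he : IsListing m₀ n₀ c e) (he' : IsListing m₀ n₀ c e') : obs f φ e = obs f φ e' := by
  obtain ⟨σ, h1, h2⟩ := he.exists_perm hf he'
  have hmp := measurePreserving_comp_perm σ
  have hm : AEStronglyMeasurable (fun v : Fin n → ℝ => f v * φ (v ∘ e))
      (volume.map fun v : Fin n → ℝ => v ∘ σ) := by
    rw [hmp.map_eq]
    exact ((hφ.comp_positions e).integrable_mul (L1.integrable_coeFn f)).aestronglyMeasurable
  have h3 := integral_map hmp.aemeasurable hm
  rw [hmp.map_eq] at h3
  rw [obs, h3, obs]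
  refine integral_congr_ae ?_
  filter_upwards [h1] with v hv
  rw [hv]
  congr 2
  funext i
  exact congrArg v (h2 i)

/-! ### Chaos versus uniform chaos -/

theorem firstCoords_eq {n l : ℕ} (h : l ≤ n) (v : Fin n → ℝ) :
    firstCoords l v = v ∘ Fin.castLE h := by
  funext i
  rw [firstCoords, dif_pos (i.isLt.trans_le h)]
  rfl

theorem IsTest.memLp {X : Type*} [MeasurableSpace X] {μ : Measure X} {φ : X → ℝ} {K : ℝ}
    (h : IsTest φ K) : MemLp φ ⊤ μ :=
  memLp_top_of_bound h.measurable.aestronglyMeasurable K (Eventually.of_forall h.abs_le)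

/-- Clipping a measurable representative at the essential bound gives a function bounded everywhere,
as the pointwise definitions of the adjoint operators require. -/
theorem exists_isTest_of_memLp {X : Type*} [MeasurableSpace X] {μ : Measure X} {φ : X → ℝ}
    (h : MemLp φ ⊤ μ) : ∃ (ψ : X → ℝ) (K : ℝ), IsTest ψ K ∧ φ =ᵐ[μ] ψ := by
  obtain ⟨C, hC⟩ : ∃ C, ∀ᵐ x ∂μ, ‖φ x‖ ≤ C := by
    refine ⟨(eLpNorm φ ⊤ μ).toReal, ?_⟩
    have h1 := h.eLpNorm_ne_top
    rw [eLpNorm_exponent_top] at h1 ⊢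
    filter_upwards [ae_le_eLpNormEssSup (f := φ) (μ := μ)] with x hx
    rw [← toReal_enorm]
    exact ENNReal.toReal_mono h1 hx
  set K := max C 0
  have hK : -K ≤ K := by linarith [le_max_right C 0]
  refine ⟨fun x => max (-K) (min K (h.1.mk φ x)), K, ⟨?_, fun x => ?_⟩, ?_⟩
  · exact measurable_const.max (measurable_const.min h.1.stronglyMeasurable_mk.measurable)
  · exact abs_le.mpr ⟨le_max_left _ _, max_le hK (min_le_left _ _)⟩
  · filter_upwards [hC, h.1.ae_eq_mk] with x h1 h2
    have h3 := abs_le.mp (h1.trans (le_max_left C 0))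
    rw [← h2, min_eq_right h3.2, max_eq_right h3.1]

/-- A surjective linear map sends Lebesgue measure to a multiple of Lebesgue measure. So functions
of `l` variables that agree almost everywhere still do so as functions of `n` variables. -/
theorem quasiMeasurePreserving_comp {n l : ℕ} {e : Fin l → Fin n} (he : Function.Injective e) :
    Measure.QuasiMeasurePreserving fun v : Fin n → ℝ => v ∘ e := by
  obtain ⟨c, -, hc⟩ := (LinearMap.funLeft ℝ ℝ e).exists_map_addHaar_eq_smul_addHaar
    (volume : Measure (Fin n → ℝ)) (volume : Measure (Fin l → ℝ))
    (LinearMap.funLeft_surjective_of_injective ℝ ℝ e he)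
  refine ⟨measurable_pi_lambda _ fun i => measurable_pi_apply (e i), ?_⟩
  have hc' : Measure.map (fun v : Fin n → ℝ => v ∘ e) volume = c • volume := hc
  rw [hc']
  exact Measure.smul_absolutelyContinuous

theorem prod_species {m₀ n₀ l : ℕ} (a b : L1R) (v : Fin l → ℝ) :
    ∏ i : Fin l, (if i.val ∈ thermostated m₀ n₀ then a (v i) else b (v i))
      = ∏ i : Fin l, species a b (label m₀ n₀ i) (v i) := by
  refine Finset.prod_congr rfl fun i _ => ?_
  by_cases h : i.val ∈ thermostated m₀ n₀ <;> simp [h, species, label]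

theorem IsUniformlyChaotic.isChaotic {m₀ n₀ : ℕ} (hn₀ : 0 < n₀) {G : (k : ℕ) → L1 (k * n₀)}
    {a b : L1R} (ha : IsProbDensity a) (hb : IsProbDensity b)
    (h : IsUniformlyChaotic m₀ n₀ G a b) : IsChaotic m₀ n₀ G a b := by
  refine ⟨ha, hb, fun l φ hφ => ?_⟩
  obtain ⟨ψ, K, hψ, hφψ⟩ := exists_isTest_of_memLp hφ
  have e1 : ∫ v : Fin l → ℝ,
      (∏ i : Fin l, if i.val ∈ thermostated m₀ n₀ then a (v i) else b (v i)) * φ v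
      = meanField a b (fun i : Fin l => label m₀ n₀ i) ψ := by
    refine integral_congr_ae ?_
    filter_upwards [hφψ] with v hv
    rw [hv, prod_species]
  rw [e1, Metric.tendsto_nhds]
  intro ε hε
  filter_upwards [h l (fun i => label m₀ n₀ i) ψ K hψ (ε / 2) (by positivity),
    (tendsto_mul_atTop hn₀).eventually_ge_atTop l] with k hk hkl
  have e2 : ∫ v : Fin (k * n₀) → ℝ, G k v * φ (firstCoords l v)
      = obs (G k) ψ (Fin.castLE hkl) := by
    refine integral_congr_ae ?_
    filter_upwards [(quasiMeasurePreserving_comp (Fin.castLE_injective hkl)).ae_eq_comp hφψ]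
      with v hv
    rw [firstCoords_eq hkl]
    exact congrArg (G k v * ·) hv
  rw [e2, Real.dist_eq]
  exact (hk _ ⟨Fin.castLE_injective hkl, fun i => rfl⟩).trans_lt (half_lt_self hε)

theorem label_mod (m₀ n₀ i : ℕ) : label m₀ n₀ (i % n₀) = label m₀ n₀ i := by
  conv_rhs => rw [← Nat.div_add_mod' i n₀, label_add_mul]

/-- Chaos speaks of the first particles only. One listing of the species `c` among the first `l *
n₀` particles is handled by chaos with the other variables integrated out, and symmetry carries the
limit to all listings at once. -/
theorem IsChaotic.isUniformlyChaotic {m₀ n₀ : ℕ} (hn₀ : 0 < n₀) {f : (k : ℕ) → L1 (k * n₀)}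
    (hsymm : ∀ k, 1 ≤ k → IsPartiallySymmetric m₀ n₀ (f k)) {a b : L1R}
    (h : IsChaotic m₀ n₀ f a b) : IsUniformlyChaotic m₀ n₀ f a b := by
  intro l c φ K hφ ε hε
  by_cases hc : ∃ r : Fin l → ℕ, ∀ i, r i < n₀ ∧ label m₀ n₀ (r i) = c i
  · obtain ⟨r, hr⟩ := hc
    have hlt : ∀ i : Fin l, i * n₀ + r i < l * n₀ := fun i => by
      have h1 : (i.val + 1) * n₀ ≤ l * n₀ := Nat.mul_le_mul_right _ i.isLt
      have := (hr i).1
      rw [Nat.succ_mul] at h1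
      omega
    -- Slot `i` takes its particle from the `i`-th block, which makes the choices distinct whatever
    -- the species.
    let e₀ : Fin l → Fin (l * n₀) := fun i => ⟨i * n₀ + r i, hlt i⟩
    have he₀ : IsListing m₀ n₀ c e₀ := by
      refine ⟨fun i j hij => ?_, fun i => ?_⟩
      · have h1 : i.val * n₀ + r i = j.val * n₀ + r j := congrArg Fin.val hij
        have h2 : ∀ i : Fin l, (i.val * n₀ + r i) / n₀ = i.val := fun i => by
          rw [mul_comm, Nat.mul_add_div hn₀, Nat.div_eq_of_lt (hr i).1, add_zero]
        exact Fin.ext (by rw [← h2 i, ← h2 j, h1])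
      · exact (label_add_mul _ _ _ _).trans (hr i).2
    have h1 := h.2.2 (l * n₀) (fun u => φ (u ∘ e₀)) (hφ.comp_positions e₀).memLp
    have e1 : ∫ v : Fin (l * n₀) → ℝ,
        (∏ i : Fin (l * n₀), if i.val ∈ thermostated m₀ n₀ then a (v i) else b (v i)) * φ (v ∘ e₀)
        = meanField a b c φ := by
      simp only [prod_species]
      refine (tens_comp (g := fun i => species a b (label m₀ n₀ i)) he₀.injective
        (fun j => (isProbDensity_species h.1 h.2.1 _).2) φ).trans ?_
      simp only [he₀.label_eq]
      rfl
    rw [e1, Metric.tendsto_nhds] at h1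
    filter_upwards [h1 ε hε, eventually_ge_atTop l, eventually_ge_atTop 1] with k hk hkl hk1 e he
    have hle : l * n₀ ≤ k * n₀ := Nat.mul_le_mul_right _ hkl
    have he' : IsListing m₀ n₀ c (Fin.castLE hle ∘ e₀) :=
      ⟨(Fin.castLE_injective hle).comp he₀.injective, he₀.label_eq⟩
    rw [(hsymm k hk1).obs_eq hφ he he']
    rw [Real.dist_eq] at hk
    simp only [firstCoords_eq hle] at hk
    exact hk.le
  -- If some species in `c` does not occur in a block, it never occurs, and there is no listing to
  -- consider.
  · refine Eventually.of_forall fun k e he => absurd ⟨fun i => (e i).val % n₀, fun i =>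
      ⟨Nat.mod_lt _ hn₀, ?_⟩⟩ hc
    rw [label_mod, he.label_eq]

end PartialKac

end

theorem theorem3 (m₀ n₀ : ℕ) (hmn : m₀ < n₀) (lam η β : ℝ) (hlam : 0 < lam) (hη : 0 < η)
    (hβ : 0 < β)
    (f : (k : ℕ) → PartialKac.L1 (k * n₀))
    (hf : ∀ k, 1 ≤ k → PartialKac.IsProbDensity (f k))
    (hsymm : ∀ k, 1 ≤ k → PartialKac.IsPartiallySymmetric m₀ n₀ (f k))
    (a₀ b₀ : PartialKac.L1R)
    (hchaos : PartialKac.IsChaotic m₀ n₀ f a₀ b₀) :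
    (∃ a b : ℝ → PartialKac.L1R,
      PartialKac.IsBoltzmannKacSolution ((m₀ : ℝ) / (n₀ : ℝ)) lam η β a₀ b₀ a b) ∧
    ∀ a b : ℝ → PartialKac.L1R,
      PartialKac.IsBoltzmannKacSolution ((m₀ : ℝ) / (n₀ : ℝ)) lam η β a₀ b₀ a b →
      ∀ t : ℝ, 0 ≤ t →
        PartialKac.IsChaotic m₀ n₀
          (fun k => PartialKac.evolution m₀ n₀ (k * n₀) lam η β t (f k)) (a t) (b t) := by
  have hn₀ : 0 < n₀ := by omega
  have hα0 : (0 : ℝ) ≤ (m₀ : ℝ) / n₀ := by positivity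
  have hα1 : (m₀ : ℝ) / n₀ ≤ 1 := div_le_one_of_le₀ (by exact_mod_cast hmn.le) (by positivity)
  refine ⟨PartialKac.exists_isBoltzmannKacSolution hα0 hα1 hlam hη hβ hchaos.1 hchaos.2.1,
    fun a b hsol t ht => ?_⟩
  have hprob : ∀ t, 0 ≤ t → PartialKac.IsProbDensity (a t) ∧ PartialKac.IsProbDensity (b t) :=
    fun t ht => hsol.isProbDensity hα0 hα1 hlam hη hβ hchaos.1 hchaos.2.1 ht
  exact ((hchaos.isUniformlyChaotic hn₀ hsymm).evolution hmn hlam hη hβ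
    (fun k hk => (hf k hk).norm_eq.le) hsol (fun t ht => (hprob t ht).1)
    (fun t ht => (hprob t ht).2) ht).isChaotic hn₀ (hprob t ht).1 (hprob t ht).2
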